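/- Let $n\ge 1$, and let $\varphi:\mathbb{R}_+\to\mathbb{R}_+$ be a positive continuous function with $\lim_{r\to+\infty}\varphi(r)=+\infty$. An entire curve is a holomorphic map $\mathbb{C}\to\mathbb{CP}^n$. An entire curve $h$ is called universal if for every entire curve $g:\mathbb{C}\to\mathbb{CP}^n$ and every compact set $K\subset\mathbb{C}$ there is a sequence $(a_i)$ of complex numbers such that $h(\cdot+a_i)$ converges to $g$ uniformly on $K$ (with respect to the Fubini–Study distance on $\mathbb{CP}^n$). Then there exists a universal entire curve $h:\mathbb{C}\to\mathbb{CP}^n$ such that $$T_h(r)\le \varphi(r)\cdot\log r\qquad\text{for all } r\ge 1,$$ where $$T_h(r):=\int_1^r\frac{dt}{t}\int_{|z|<t}h^*\omega_{\mathrm{FS}}$$ is the Nevanlinna (Shimizu–Ahlfors) characteristic function of $h$, and $\omega_{\mathrm{FS}}$ is the Fubini–Study form, $\omega_{\mathrm{FS}}=\frac{i}{2\pi}\partial\bar\partial\log(|Z_0|^2+\dots+|Z_n|^2)$ in homogeneous coordinates. -/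

import Mathlib

open Filter Topology MeasureTheory
open scoped ComplexConjugate

namespace UniversalCurve

/-- Complex projective space `ℂℙⁿ`, the set of lines of the Hermitian space `ℂⁿ⁺¹`. -/
abbrev CP (n : ℕ) : Type := Projectivization ℂ (EuclideanSpace ℂ (Fin (n + 1)))

/-- The Fubini-Study distance on `ℂℙⁿ`: the angle `arccos (|⟨v, w⟩| / (‖v‖ ‖w‖))` between the
complex lines spanned by `v` and `w` (see `fsDist_mk` for the independence of `v` and `w`). -/
noncomputable def fsDist {n : ℕ} (p q : CP n) : ℝ :=
  Real.arccos (‖inner ℂ p.rep q.rep‖ / (‖p.rep‖ * ‖q.rep‖))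

theorem fsDist_mk {n : ℕ} (v w : EuclideanSpace ℂ (Fin (n + 1))) (hv : v ≠ 0) (hw : w ≠ 0) :
    fsDist (Projectivization.mk ℂ v hv) (Projectivization.mk ℂ w hw) =
      Real.arccos (‖inner ℂ v w‖ / (‖v‖ * ‖w‖)) := by
  obtain ⟨a, ha⟩ := Projectivization.exists_smul_eq_mk_rep ℂ v hv
  obtain ⟨b, hb⟩ := Projectivization.exists_smul_eq_mk_rep ℂ w hw
  have ha0 : ‖(a : ℂ)‖ ≠ 0 := norm_ne_zero_iff.mpr a.ne_zero
  have hb0 : ‖(b : ℂ)‖ ≠ 0 := norm_ne_zero_iff.mpr b.ne_zero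
  have hv0 : ‖v‖ ≠ 0 := norm_ne_zero_iff.mpr hv
  have hw0 : ‖w‖ ≠ 0 := norm_ne_zero_iff.mpr hw
  unfold fsDist
  rw [← ha, ← hb, Units.smul_def, Units.smul_def, inner_smul_left, inner_smul_right,
    norm_smul, norm_smul, norm_mul, norm_mul, RCLike.norm_conj]
  congr 1
  field_simp

/-- `F` is a holomorphic lift of `f` near `z`: `F` is a nowhere vanishing holomorphic map to
`ℂⁿ⁺¹` near `z`, and `f = [F]` there. -/
def IsLocalLift {n : ℕ} (F : ℂ → EuclideanSpace ℂ (Fin (n + 1))) (f : ℂ → CP n) (z : ℂ) : Prop :=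
  AnalyticAt ℂ F z ∧ ∀ᶠ w in 𝓝 z, ∃ hw : F w ≠ 0, f w = Projectivization.mk ℂ (F w) hw

/-- An entire curve is a holomorphic map `ℂ → ℂℙⁿ`, that is, a map given near each point by
homogeneous coordinates that are holomorphic and have no common zero. -/
def IsEntireCurve {n : ℕ} (f : ℂ → CP n) : Prop :=
  ∀ z : ℂ, ∃ F : ℂ → EuclideanSpace ℂ (Fin (n + 1)), IsLocalLift F f z

/-- An entire curve `h` is universal if for every entire curve `g` and every compact `K ⊆ ℂ`
there is a sequence `aᵢ` such that the translates `h(· + aᵢ)` converge to `g` uniformly on `K`. -/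
def IsUniversal {n : ℕ} (h : ℂ → CP n) : Prop :=
  IsEntireCurve h ∧ ∀ g : ℂ → CP n, IsEntireCurve g → ∀ K : Set ℂ, IsCompact K →
    ∃ a : ℕ → ℂ, ∀ ε : ℝ, 0 < ε → ∀ᶠ i in atTop, ∀ z ∈ K, fsDist (h (z + a i)) (g z) < ε

/-- The Fubini-Study form `(i/2π) ∂∂̄ log ‖Z‖²`, as a real 2-form on `ℂⁿ⁺¹ \ {0}`, at the point
`v` and on the real tangent vectors `X`, `Y`. -/
noncomputable def fsForm {n : ℕ} (v X Y : EuclideanSpace ℂ (Fin (n + 1))) : ℝ :=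
  1 / Real.pi * (inner ℂ X Y / (‖v‖ : ℂ) ^ 2
    - inner ℂ X v * inner ℂ v Y / (‖v‖ : ℂ) ^ 4).im

/-- The form is basic for the projection to `ℂℙⁿ`: scaling the point and adding vertical
vectors does not change it. -/
theorem fsForm_smul {n : ℕ} (v X Y : EuclideanSpace ℂ (Fin (n + 1))) (hv : v ≠ 0)
    (a b c : ℂ) (ha : a ≠ 0) :
    fsForm (a • v) (b • v + a • X) (c • v + a • Y) = fsForm v X Y := by
  have hv0 : (‖v‖ : ℂ) ≠ 0 := by exact_mod_cast norm_ne_zero_iff.mpr hv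
  have hca : conj a ≠ 0 := by simpa using ha
  have h2 : ((‖a‖ * ‖v‖ : ℝ) : ℂ) ^ 2 = conj a * a * (‖v‖ : ℂ) ^ 2 := by
    push_cast
    rw [mul_pow, Complex.conj_mul']
  have h4 : ((‖a‖ * ‖v‖ : ℝ) : ℂ) ^ 4 = (conj a * a * (‖v‖ : ℂ) ^ 2) ^ 2 := by
    rw [← h2]
    ring
  have hvv : inner ℂ v v = (‖v‖ : ℂ) ^ 2 := inner_self_eq_norm_sq_to_K v
  unfold fsForm
  congr 2
  rw [norm_smul, h2, h4]
  simp only [inner_add_left, inner_add_right, inner_smul_left, inner_smul_right, hvv]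
  field_simp
  ring

open Classical in
/-- The density of the pull-back `f^* ω_FS` with respect to Lebesgue measure `dx dy`, which is the
value of `F^* ω_FS` on `(∂/∂x, ∂/∂y)` for any local lift `F` of `f`
(see `pullbackFS_eq` for the independence of the lift). -/
noncomputable def pullbackFS {n : ℕ} (f : ℂ → CP n) (z : ℂ) : ℝ :=
  if h : ∃ F : ℂ → EuclideanSpace ℂ (Fin (n + 1)), IsLocalLift F f z then
    fsForm (h.choose z) (deriv h.choose z) (Complex.I • deriv h.choose z)
  else 0

theorem fsForm_deriv_eq {n : ℕ} {F G : ℂ → EuclideanSpace ℂ (Fin (n + 1))} {f : ℂ → CP n} {z : ℂ}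
    (hF : IsLocalLift F f z) (hG : IsLocalLift G f z) :
    fsForm (F z) (deriv F z) (Complex.I • deriv F z) =
      fsForm (G z) (deriv G z) (Complex.I • deriv G z) := by
  have hFd := hF.1.differentiableAt
  have hGd := hG.1.differentiableAt
  obtain ⟨hFz, -⟩ := hF.2.self_of_nhds
  obtain ⟨hGz, -⟩ := hG.2.self_of_nhds
  have hp : ∀ {H : ℂ → EuclideanSpace ℂ (Fin (n + 1))}, DifferentiableAt ℂ H z →
      DifferentiableAt ℂ (fun w => inner ℂ (G z) (H w)) z := fun {H} hH =>
    (innerSL ℂ (G z)).differentiableAt.comp z hH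
  have hne : inner ℂ (G z) (G z) ≠ 0 := inner_self_ne_zero.mpr hGz
  have hev : F =ᶠ[𝓝 z] fun w => (inner ℂ (G z) (F w) / inner ℂ (G z) (G w)) • G w := by
    filter_upwards [hF.2, hG.2, (hp hGd).continuousAt.eventually_ne hne] with w h1 h2 h3
    obtain ⟨h1, h1'⟩ := h1
    obtain ⟨h2, h2'⟩ := h2
    obtain ⟨a, ha⟩ := (Projectivization.mk_eq_mk_iff' ℂ _ _ h1 h2).1 (h1'.symm.trans h2')
    rw [← ha, inner_smul_right, mul_div_cancel_right₀ _ h3]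
  set l : ℂ → ℂ := fun w => inner ℂ (G z) (F w) / inner ℂ (G z) (G w) with hl_def
  have hl : DifferentiableAt ℂ l z := (hp hFd).div (hp hGd) hne
  have hval : F z = l z • G z := hev.self_of_nhds
  have hder : deriv F z = deriv l z • G z + l z • deriv G z := by
    rw [hev.deriv_eq, deriv_fun_smul hl hGd]
    exact add_comm _ _
  have ha : l z ≠ 0 := by
    intro h0
    rw [h0, zero_smul] at hval
    exact hFz hval
  have hder' : Complex.I • deriv F z =
      (Complex.I * deriv l z) • G z + l z • (Complex.I • deriv G z) := by
    rw [hder, smul_add, smul_smul, smul_comm]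
  rw [hder', hder, hval]
  exact fsForm_smul _ _ _ hGz _ _ _ ha

theorem pullbackFS_eq {n : ℕ} {F : ℂ → EuclideanSpace ℂ (Fin (n + 1))} {f : ℂ → CP n} {z : ℂ}
    (hF : IsLocalLift F f z) :
    pullbackFS f z = fsForm (F z) (deriv F z) (Complex.I • deriv F z) := by
  have h : ∃ F : ℂ → EuclideanSpace ℂ (Fin (n + 1)), IsLocalLift F f z := ⟨F, hF⟩
  rw [pullbackFS, dif_pos h]
  exact fsForm_deriv_eq h.choose_spec hF

/-- The Nevanlinna characteristic function, in the version of Shimizu and Ahlfors: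
`T_f(r) = ∫₁ʳ (dt/t) ∫_{|z|<t} f^* ω_FS`. -/
noncomputable def characteristic {n : ℕ} (f : ℂ → CP n) (r : ℝ) : ℝ :=
  ∫ t in (1 : ℝ)..r, 1 / t * ∫ z in Metric.ball (0 : ℂ) t, pullbackFS f z

end UniversalCurve

/-!
The curve is a superposition of very sparse translates of countably many rational curves.

A *block* is a nowhere vanishing entire map `p : ℂ → ℂⁿ⁺¹` for which the affine coordinates
`f = p / p₀ - e₀` of the curve `[p]` are `O(|w|⁻⁴)` at infinity. Blocks approximate every entire
curve `g`, uniformly on discs: `g` has a nowhere vanishing holomorphic lift on a disc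
(`IsEntireCurve.exists_lift_closedBall`), a Taylor polynomial of the lift is close to it, and adding
a small multiple of a high power of `z` to the coordinate `0`, together with small constants that
remove the common zeros, turns this polynomial into a block (`exists_isBlock_near_polynomial`). As
`C(ℂ, ℂⁿ⁺¹)` is second countable, a sequence of blocks suffices (`exists_dense_seq_isBlock`).

Given such a sequence `pⱼ` with every term repeated infinitely often, put
`h(z) = [e₀ + ∑ⱼ fⱼ(z - aⱼ)]`. Near `aᵢ` this is the curve `[pᵢ(z - aᵢ) + pᵢ₀(z - aᵢ) sᵢ(z)]` with
`sᵢ(z) = ∑_{j ≠ i} fⱼ(z - aⱼ)`. When the centres `aⱼ` are far apart, `sᵢ` is tiny on the disc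
`|z - aᵢ| ≤ ρᵢ`, so `h(· + aᵢ)` is close to `[pᵢ]` on `|z| ≤ ρᵢ`, and `h` is universal
(`Arrangement.isUniversal_curve`).

For the growth, the density of `h^* ω_FS` is at most `‖F'‖² / ‖F‖²` for every local lift `F`. On the
`i`-th disc this is at most a constant `bᵢ` that does not depend on the centres. Off the discs the
lift `e₀ + ∑ⱼ fⱼ(z - aⱼ)` has norm at least `1`, and the radii `ρⱼ` are so large that the derivative
is at most `ε ∑ⱼ 2⁻ʲ⁻¹ (1 + |z - aⱼ|)⁻³`; this part of the plane contributes an arbitrarily small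
area, again independently of the centres (`Arrangement.integral_pullbackFS_le`). Hence the area of
`h` over `|z| < r` is at most a small constant plus the sum of the contributions of the discs that
meet `|z| < r`. Since `φ → ∞`, the centres can go to infinity so fast that this is at most `φ(r)`
for `r ≥ 1`, and integrating against `dt / t` gives `T_h(r) ≤ φ(r) log r`.
-/

namespace UniversalCurve

/-! ### The Fubini-Study distance and the area density -/

/-- Vectors that are close relative to their length span lines that are close. This is the only
property of the Fubini-Study distance that the proof uses. -/
theorem exists_fsDist_lt {n : ℕ} {ε : ℝ} (hε : 0 < ε) :
    ∃ δ : ℝ, 0 < δ ∧ ∀ (v w : EuclideanSpace ℂ (Fin (n + 1))) (hv : v ≠ 0) (hw : w ≠ 0),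
      ‖v - w‖ ≤ δ * ‖w‖ →
      fsDist (Projectivization.mk ℂ v hv) (Projectivization.mk ℂ w hw) < ε := by
  -- If `‖v - w‖ ≤ t ‖w‖`, then `|⟨v, w⟩| / (‖v‖ ‖w‖) ≥ (1 - t) / (1 + t)`.
  have hc : ContinuousAt (fun t : ℝ => Real.arccos ((1 - t) / (1 + t))) 0 := by
    refine Real.continuous_arccos.continuousAt.comp ?_
    exact ContinuousAt.div (by fun_prop) (by fun_prop) (by norm_num)
  have hev : ∀ᶠ t : ℝ in 𝓝 0, Real.arccos ((1 - t) / (1 + t)) < ε :=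
    hc.eventually_lt continuousAt_const (by simpa using hε)
  obtain ⟨δ, hδ, hball⟩ := Metric.eventually_nhds_iff.1 hev
  refine ⟨δ / 2, by positivity, fun v w hv hw hvw => ?_⟩
  have hδ' : Real.arccos ((1 - δ / 2) / (1 + δ / 2)) < ε := hball (by
    rw [Real.dist_eq, sub_zero, abs_of_pos (by positivity)]; linarith)
  rw [fsDist_mk]
  refine lt_of_le_of_lt (Real.arccos_le_arccos ?_) hδ'
  have hv0 : 0 < ‖v‖ := norm_pos_iff.2 hv
  have hw0 : 0 < ‖w‖ := norm_pos_iff.2 hw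
  have h1 : ‖v‖ ≤ (1 + δ / 2) * ‖w‖ := by
    have := norm_add_le (v - w) w
    rw [sub_add_cancel] at this
    linarith
  have h2 : (1 - δ / 2) * ‖w‖ ^ 2 ≤ ‖inner ℂ v w‖ := by
    have h3 : inner ℂ v w = inner ℂ (v - w) w + (‖w‖ : ℂ) ^ 2 := by
      rw [inner_sub_left]
      have : inner ℂ w w = (‖w‖ : ℂ) ^ 2 := inner_self_eq_norm_sq_to_K w
      rw [this]; ring
    have h4 : ‖(‖w‖ : ℂ) ^ 2‖ = ‖w‖ ^ 2 := by simp
    have h5 := norm_le_add_norm_add ((‖w‖ : ℂ) ^ 2) (inner ℂ (v - w) w)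
    have h6 := norm_inner_le_norm (𝕜 := ℂ) (v - w) w
    rw [add_comm ((‖w‖ : ℂ) ^ 2), ← h3, h4] at h5
    nlinarith
  rw [div_le_div_iff₀ (by positivity) (by positivity)]
  by_cases hδ1 : δ / 2 ≤ 1
  · calc (1 - δ / 2) * (‖v‖ * ‖w‖) ≤ (1 - δ / 2) * ((1 + δ / 2) * ‖w‖ * ‖w‖) := by
          gcongr
      _ = (1 - δ / 2) * ‖w‖ ^ 2 * (1 + δ / 2) := by ring
      _ ≤ _ := by gcongr
  · have : (1 - δ / 2) * (‖v‖ * ‖w‖) ≤ 0 :=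
      mul_nonpos_of_nonpos_of_nonneg (by linarith) (by positivity)
    exact this.trans (by positivity)

theorem fsForm_I_smul {n : ℕ} (v X : EuclideanSpace ℂ (Fin (n + 1))) :
    fsForm v X (Complex.I • X) =
      1 / Real.pi * (‖X‖ ^ 2 / ‖v‖ ^ 2 - ‖inner ℂ X v‖ ^ 2 / ‖v‖ ^ 4) := by
  have hX : inner ℂ X X = (‖X‖ : ℂ) ^ 2 := inner_self_eq_norm_sq_to_K X
  have hXv : inner ℂ X v * inner ℂ v X = (‖inner ℂ X v‖ : ℂ) ^ 2 := by
    rw [← inner_conj_symm v X, Complex.mul_conj']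
  unfold fsForm
  congr 1
  rw [inner_smul_right, inner_smul_right, hX,
    show inner ℂ X v * (Complex.I * inner ℂ v X) = Complex.I * (inner ℂ X v * inner ℂ v X) by ring,
    hXv]
  rw [show Complex.I * (‖X‖ : ℂ) ^ 2 / (‖v‖ : ℂ) ^ 2
      - Complex.I * (‖inner ℂ X v‖ : ℂ) ^ 2 / (‖v‖ : ℂ) ^ 4 =
      Complex.I * ((‖X‖ ^ 2 / ‖v‖ ^ 2 - ‖inner ℂ X v‖ ^ 2 / ‖v‖ ^ 4 : ℝ) : ℂ) by
    push_cast; ring]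
  rw [Complex.I_mul_im, Complex.ofReal_re]

theorem fsForm_I_smul_nonneg {n : ℕ} (v X : EuclideanSpace ℂ (Fin (n + 1))) :
    0 ≤ fsForm v X (Complex.I • X) := by
  rw [fsForm_I_smul]
  refine mul_nonneg (by positivity) (sub_nonneg.2 ?_)
  rcases eq_or_ne v 0 with rfl | hv
  · simp
  have hv0 : 0 < ‖v‖ := norm_pos_iff.2 hv
  rw [div_le_div_iff₀ (by positivity) (by positivity)]
  have h := norm_inner_le_norm (𝕜 := ℂ) X v
  calc ‖inner ℂ X v‖ ^ 2 * ‖v‖ ^ 2 ≤ (‖X‖ * ‖v‖) ^ 2 * ‖v‖ ^ 2 := by gcongr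
    _ = ‖X‖ ^ 2 * ‖v‖ ^ 4 := by ring

theorem fsForm_I_smul_le {n : ℕ} (v X : EuclideanSpace ℂ (Fin (n + 1))) :
    fsForm v X (Complex.I • X) ≤ ‖X‖ ^ 2 / ‖v‖ ^ 2 := by
  rw [fsForm_I_smul]
  have h1 : 1 / Real.pi ≤ 1 := by
    rw [div_le_one Real.pi_pos]; linarith [Real.pi_gt_three]
  have h2 : 0 ≤ ‖inner ℂ X v‖ ^ 2 / ‖v‖ ^ 4 := by positivity
  have h3 : 0 ≤ ‖X‖ ^ 2 / ‖v‖ ^ 2 := by positivity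
  calc _ ≤ 1 / Real.pi * (‖X‖ ^ 2 / ‖v‖ ^ 2) := by gcongr; linarith
    _ ≤ 1 * (‖X‖ ^ 2 / ‖v‖ ^ 2) := by gcongr
    _ = _ := one_mul _

theorem pullbackFS_nonneg {n : ℕ} (f : ℂ → CP n) (z : ℂ) : 0 ≤ pullbackFS f z := by
  unfold pullbackFS
  split_ifs with h
  · exact fsForm_I_smul_nonneg _ _
  · exact le_rfl

/-- The area density is bounded through any local lift, so a lift adapted to each region can be
used. -/
theorem pullbackFS_le {n : ℕ} {F : ℂ → EuclideanSpace ℂ (Fin (n + 1))} {f : ℂ → CP n} {z : ℂ}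
    (hF : IsLocalLift F f z) : pullbackFS f z ≤ ‖deriv F z‖ ^ 2 / ‖F z‖ ^ 2 := by
  rw [pullbackFS_eq hF]
  exact fsForm_I_smul_le _ _

/-- Only the upper bound is required to be integrable, so nothing about the measurability of
`pullbackFS` enters. -/
theorem characteristic_le {n : ℕ} {f : ℂ → CP n} {r C : ℝ} (hr : 1 ≤ r)
    (hA : ∀ t ∈ Set.Ioc 1 r, ∫ z in Metric.ball (0 : ℂ) t, pullbackFS f z ≤ C) :
    characteristic f r ≤ C * Real.log r := by
  unfold characteristic
  have hint : IntervalIntegrable (fun t : ℝ => 1 / t * C) volume 1 r := by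
    refine ContinuousOn.intervalIntegrable ?_
    rw [Set.uIcc_of_le hr]
    refine ContinuousOn.mul (continuousOn_const.div continuousOn_id fun t ht => ?_)
      continuousOn_const
    exact (zero_lt_one.trans_le ht.1).ne'
  have hval : ∫ t in (1 : ℝ)..r, 1 / t * C = C * Real.log r := by
    rw [intervalIntegral.integral_mul_const, integral_one_div_of_pos one_pos (by linarith),
      div_one, mul_comm]
  rw [← hval, intervalIntegral.integral_of_le hr, intervalIntegral.integral_of_le hr]
  refine integral_mono_of_nonneg ?_ ((intervalIntegrable_iff_integrableOn_Ioc_of_le hr).1 hint) ?_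
  · filter_upwards [ae_restrict_mem measurableSet_Ioc] with t ht
    exact mul_nonneg (one_div_nonneg.2 (by linarith [ht.1]))
      (integral_nonneg fun z => pullbackFS_nonneg f z)
  · filter_upwards [ae_restrict_mem measurableSet_Ioc] with t ht
    exact mul_le_mul_of_nonneg_left (hA t ht) (one_div_nonneg.2 (by linarith [ht.1]))

/-! ### Holomorphic lifts on discs -/

theorem rep_mk_apply_eq_zero_iff {n : ℕ} (v : EuclideanSpace ℂ (Fin (n + 1))) (hv : v ≠ 0)
    (j : Fin (n + 1)) : (Projectivization.mk ℂ v hv).rep j = 0 ↔ v j = 0 := by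
  obtain ⟨a, ha⟩ := Projectivization.exists_smul_eq_mk_rep ℂ v hv
  rw [← ha, Units.smul_def, PiLp.smul_apply, smul_eq_mul, mul_eq_zero]
  simp

theorem inv_smul_rep_mk {n : ℕ} (v : EuclideanSpace ℂ (Fin (n + 1))) (hv : v ≠ 0)
    (j : Fin (n + 1)) :
    ((Projectivization.mk ℂ v hv).rep j)⁻¹ • (Projectivization.mk ℂ v hv).rep = (v j)⁻¹ • v := by
  obtain ⟨a, ha⟩ := Projectivization.exists_smul_eq_mk_rep ℂ v hv
  rw [← ha, Units.smul_def, PiLp.smul_apply, smul_eq_mul, smul_smul, mul_inv, mul_assoc,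
    mul_comm (v j)⁻¹, ← mul_assoc, inv_mul_cancel₀ a.ne_zero, one_mul]

theorem analyticAt_coord {n : ℕ} {F : ℂ → EuclideanSpace ℂ (Fin (n + 1))} {z : ℂ}
    (hF : AnalyticAt ℂ F z) (j : Fin (n + 1)) : AnalyticAt ℂ (fun w => F w j) z :=
  ((EuclideanSpace.proj (𝕜 := ℂ) j).analyticAt (F z)).comp hF

theorem IsLocalLift.smul {n : ℕ} {F : ℂ → EuclideanSpace ℂ (Fin (n + 1))} {f : ℂ → CP n} {z : ℂ}
    (hF : IsLocalLift F f z) {l : ℂ → ℂ} (hl : AnalyticAt ℂ l z) (hlz : l z ≠ 0) :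
    IsLocalLift (fun w => l w • F w) f z := by
  refine ⟨hl.smul hF.1, ?_⟩
  filter_upwards [hF.2, hl.continuousAt.eventually_ne hlz] with w hw hlw
  obtain ⟨hw, hfw⟩ := hw
  refine ⟨smul_ne_zero hlw hw, ?_⟩
  rw [hfw]
  exact ((Projectivization.mk_eq_mk_iff' ℂ _ _ _ _).2 ⟨l w, rfl⟩).symm

theorem IsLocalLift.congr {n : ℕ} {F G : ℂ → EuclideanSpace ℂ (Fin (n + 1))} {f : ℂ → CP n}
    {z : ℂ} (hF : IsLocalLift F f z) (h : F =ᶠ[𝓝 z] G) : IsLocalLift G f z := by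
  refine ⟨hF.1.congr h, ?_⟩
  filter_upwards [hF.2, h] with w hw hFG
  simpa only [← hFG] using hw

/-- By the identity theorem, a homogeneous coordinate that does not vanish at `0` has isolated
zeros. -/
theorem IsEntireCurve.exists_coord_ne_zero {n : ℕ} {g : ℂ → CP n} (hg : IsEntireCurve g) :
    ∃ j : Fin (n + 1), ∀ z : ℂ, ∀ᶠ w in 𝓝[≠] z, (g w).rep j ≠ 0 := by
  obtain ⟨j, hj⟩ : ∃ j, (g 0).rep j ≠ 0 := by
    by_contra! h
    exact (g 0).rep_nonzero (by ext i; simpa using h i)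
  refine ⟨j, ?_⟩
  set A : Set ℂ := {z | ∀ᶠ w in 𝓝 z, (g w).rep j = 0} with hA
  have hdich : ∀ z, z ∉ A → ∀ᶠ w in 𝓝[≠] z, (g w).rep j ≠ 0 := by
    intro z hz
    obtain ⟨F, hF⟩ := hg z
    have hiff : ∀ᶠ w in 𝓝 z, ((g w).rep j = 0 ↔ F w j = 0) := by
      filter_upwards [hF.2] with w hw
      obtain ⟨hw, hgw⟩ := hw
      rw [hgw, rep_mk_apply_eq_zero_iff]
    rcases (analyticAt_coord hF.1 j).eventually_eq_zero_or_eventually_ne_zero with h | h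
    · refine absurd ?_ hz
      filter_upwards [h, hiff] with w h1 h2 using h2.2 h1
    · filter_upwards [h, hiff.filter_mono nhdsWithin_le_nhds] with w h1 h2
      exact fun h3 => h1 (h2.1 h3)
  have hopen : IsOpen A := isOpen_setOfPred_eventually_nhds
  have hclosed : IsClosed A := by
    rw [← isOpen_compl_iff, isOpen_iff_mem_nhds]
    intro z hz
    have h := eventually_nhdsWithin_iff.1 (hdich z hz)
    filter_upwards [h] with w hw
    by_cases hwz : w = z
    · rwa [hwz]
    · exact fun hwA => hw hwz hwA.self_of_nhds
  rcases isClopen_iff.1 ⟨hclosed, hopen⟩ with h | h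
  · exact fun z => hdich z (by simp [h])
  · exact absurd (Filter.Eventually.self_of_nhds (show (0 : ℂ) ∈ A by simp [h])) hj

/-- An entire curve has a holomorphic lift on every disc. A coordinate `j` with isolated zeros has
finitely many zeros on the disc; if `P` is a polynomial with the same zeros and multiplicities, then
the local lifts `(P / Fⱼ) • F` do not depend on the local lift `F`, and fit together. -/
theorem IsEntireCurve.exists_lift_closedBall {n : ℕ} {g : ℂ → CP n} (hg : IsEntireCurve g)
    (R : ℝ) : ∃ G : ℂ → EuclideanSpace ℂ (Fin (n + 1)),
      ∀ z ∈ Metric.closedBall (0 : ℂ) R, IsLocalLift G g z := by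
  obtain ⟨j, hj⟩ := hg.exists_coord_ne_zero
  choose F hF using hg
  have hiff : ∀ z, ∀ᶠ w in 𝓝 z, ((g w).rep j = 0 ↔ F z w j = 0) ∧
      ((g w).rep j)⁻¹ • (g w).rep = (F z w j)⁻¹ • F z w := by
    intro z
    filter_upwards [(hF z).2] with w hw
    obtain ⟨hw, hgw⟩ := hw
    rw [hgw]
    exact ⟨rep_mk_apply_eq_zero_iff _ _ _, inv_smul_rep_mk _ _ _⟩
  have hfin : {w ∈ Metric.closedBall (0 : ℂ) R | (g w).rep j = 0}.Finite := by
    by_contra hinf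
    obtain ⟨x, -, hx⟩ := Set.Infinite.exists_accPt_of_subset_isCompact hinf
      (isCompact_closedBall (0 : ℂ) R) (Set.sep_subset _ _)
    rw [accPt_iff_frequently_nhdsNE] at hx
    exact hx ((hj x).mono fun w hw h => hw h.2)
  have hfac : ∀ z, ∃ (m : ℕ) (k : ℂ → ℂ), AnalyticAt ℂ k z ∧ k z ≠ 0 ∧
      ∀ᶠ w in 𝓝 z, F z w j = (w - z) ^ m * k w := by
    intro z
    have han := analyticAt_coord (hF z).1 j
    have htop : analyticOrderAt (fun w => F z w j) z ≠ ⊤ := by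
      rw [Ne, analyticOrderAt_eq_top]
      intro h
      obtain ⟨w, ⟨h1, h2⟩, h3, -⟩ := (((hj z).and (h.filter_mono nhdsWithin_le_nhds)).and
        ((hiff z).filter_mono nhdsWithin_le_nhds)).exists
      exact h1 (h3.2 h2)
    obtain ⟨k, hk, hkz, hev⟩ := han.analyticOrderAt_ne_top.1 htop
    exact ⟨_, k, hk, hkz, hev⟩
  choose m k hk hkz hfac using hfac
  set Z : Finset ℂ := hfin.toFinset with hZ
  -- `m z` is the multiplicity of `z` as a zero of the `j`-th coordinate.
  have hm : ∀ z, (g z).rep j ≠ 0 → m z = 0 := by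
    intro z hz
    by_contra hmz
    have h := (hfac z).self_of_nhds
    rw [sub_self, zero_pow hmz, zero_mul] at h
    exact hz ((hiff z).self_of_nhds.1.2 h)
  -- `P z` is the polynomial `∏ v ∈ Z, (w - v) ^ m v` without its factor at `z`, if there is one.
  set P : ℂ → ℂ → ℂ := fun z w => ∏ v ∈ Z.erase z, (w - v) ^ m v with hP
  have hPz : ∀ z, P z z ≠ 0 := fun z => Finset.prod_ne_zero_iff.2 fun v hv =>
    pow_ne_zero _ (sub_ne_zero.2 (Finset.ne_of_mem_erase hv).symm)
  have hPan : ∀ z, AnalyticAt ℂ (P z) z := fun z => by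
    apply Finset.analyticAt_fun_prod
    intro v _
    fun_prop
  refine ⟨fun w => (P w w / k w w) • F w w, fun z hz => ?_⟩
  have hl : IsLocalLift (fun w => (P z w / k z w) • F z w) g z :=
    (hF z).smul ((hPan z).div (hk z) (hkz z)) (div_ne_zero (hPz z) (hkz z))
  refine hl.congr ?_
  have hjz := eventually_nhdsWithin_iff.1 (hj z)
  filter_upwards [hjz, hiff z, hfac z] with w hw hiffw hfacw
  -- Off `z`, both lifts are the product of the polynomial and the point of the line `g w` whose
  -- `j`-th coordinate is `1`.
  by_cases hwz : w = z
  · rw [hwz]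
  have hcw : (g w).rep j ≠ 0 := hw hwz
  have hwZ : w ∉ Z := by simp [hZ, hcw]
  have hprod : P w w = (w - z) ^ m z * P z w := by
    simp only [hP, Finset.erase_eq_of_notMem hwZ]
    by_cases hzZ : z ∈ Z
    · exact (Finset.mul_prod_erase Z (fun v => (w - v) ^ m v) hzZ).symm
    · have hcz : (g z).rep j ≠ 0 := fun h => hzZ (by simpa [hZ, h] using hz)
      rw [hm z hcz, pow_zero, one_mul, Finset.erase_eq_of_notMem hzZ]
  have hkw : k w w = F w w j := by
    have h := (hfac w).self_of_nhds
    rw [hm w hcw, pow_zero, one_mul] at h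
    exact h.symm
  have hk0 : (w - z) ^ m z ≠ 0 := pow_ne_zero _ (sub_ne_zero.2 hwz)
  have h2 := (hiff w).self_of_nhds.2
  calc (P z w / k z w) • F z w = (P w w / F z w j) • F z w := by
        rw [hprod, hfacw, mul_div_mul_left _ _ hk0]
    _ = P w w • ((F z w j)⁻¹ • F z w) := by rw [smul_smul, div_eq_mul_inv]
    _ = P w w • ((F w w j)⁻¹ • F w w) := by rw [← hiffw.2, h2]
    _ = (P w w / k w w) • F w w := by rw [smul_smul, hkw, div_eq_mul_inv]

/-! ### Blocks and their density -/

/-- The affine coordinates `p / p₀ - e₀` of the curve `[p]`, as a vector whose coordinate `0`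
vanishes wherever `p₀` does not. -/
noncomputable def affinePart {n : ℕ} (p : ℂ → EuclideanSpace ℂ (Fin (n + 1))) (w : ℂ) :
    EuclideanSpace ℂ (Fin (n + 1)) :=
  (p w 0)⁻¹ • p w - EuclideanSpace.single 0 1

theorem differentiableAt_affinePart {n : ℕ} {p : ℂ → EuclideanSpace ℂ (Fin (n + 1))} {w : ℂ}
    (hp : DifferentiableAt ℂ p w) (h0 : p w 0 ≠ 0) : DifferentiableAt ℂ (affinePart p) w :=
  (((differentiableAt_euclidean.1 hp 0).inv h0).smul hp).sub_const _

/-- A block: a nowhere vanishing entire map `p` to `ℂⁿ⁺¹` such that the curve `[p]` tends to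
`[1 : 0 : ⋯ : 0]` at infinity, with affine coordinates `O(|w|⁻⁴)`. -/
structure IsBlock {n : ℕ} (p : ℂ → EuclideanSpace ℂ (Fin (n + 1))) : Prop where
  differentiable : Differentiable ℂ p
  ne_zero : ∀ z, p z ≠ 0
  decay : ∃ C ρ : ℝ, ∀ w, ρ ≤ ‖w‖ → p w 0 ≠ 0 ∧ ‖affinePart p w‖ ≤ C / ‖w‖ ^ 4

theorem exists_small_real_notMem {A : Set ℂ} (hA : A.Finite) {ε : ℝ} (hε : 0 < ε) :
    ∃ δ : ℝ, 0 < δ ∧ δ < ε ∧ (δ : ℂ) ∉ A := by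
  have hfin : ((fun x : ℝ => (x : ℂ)) ⁻¹' A).Finite :=
    hA.preimage Complex.ofReal_injective.injOn
  obtain ⟨δ, hδ, hδA⟩ := (Set.Ioo_infinite hε).exists_notMem_finite hfin
  exact ⟨δ, hδ.1, hδ.2, hδA⟩

/-- Every polynomial map is close to a block. Adding a multiple of `z ^ (N + 4)` to the coordinate
`0` makes it dominate at infinity. A small constant makes another coordinate, which exists as
`n ≥ 1`, a nonzero polynomial; its zeros are then finitely many, and a small constant keeps the
coordinate `0` away from zero there. -/
theorem exists_isBlock_near_polynomial {n : ℕ} (hn : 1 ≤ n)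
    (c : ℕ → EuclideanSpace ℂ (Fin (n + 1))) (N : ℕ) {R ε : ℝ} (hR : 0 ≤ R) (hε : 0 < ε) :
    ∃ p : ℂ → EuclideanSpace ℂ (Fin (n + 1)), IsBlock p ∧
      ∀ z ∈ Metric.closedBall (0 : ℂ) R, ‖p z - ∑ k ∈ Finset.range N, z ^ k • c k‖ < ε := by
  obtain ⟨i, hi⟩ : ∃ i : Fin (n + 1), i ≠ 0 := ⟨⟨1, by omega⟩, by simp [Fin.ext_iff]⟩
  set T : ℂ → EuclideanSpace ℂ (Fin (n + 1)) := fun z => ∑ k ∈ Finset.range N, z ^ k • c k with hT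
  have hTcoord : ∀ z l, T z l = ∑ k ∈ Finset.range N, z ^ k * c k l := by
    intro z l; simp [hT]
  obtain ⟨δ', hδ'0, hδ'ε, hδ'⟩ :=
    exists_small_real_notMem (Set.finite_singleton (-T 0 i)) (by positivity : 0 < ε / 4)
  have hzeros : {z : ℂ | T z i + δ' = 0}.Finite := by
    set Q : Polynomial ℂ :=
      ∑ k ∈ Finset.range N, Polynomial.X ^ k * Polynomial.C (c k i) + Polynomial.C (δ' : ℂ) with hQ
    have heval : ∀ z, Q.eval z = T z i + δ' := by
      intro z
      rw [hTcoord, hQ, Polynomial.eval_add, Polynomial.eval_finsetSum]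
      simp only [Polynomial.eval_mul, Polynomial.eval_pow, Polynomial.eval_X,
        Polynomial.eval_C]
    have hQ0 : Q ≠ 0 := by
      intro h
      have h0 := heval 0
      rw [h, Polynomial.eval_zero] at h0
      exact hδ' (eq_neg_of_add_eq_zero_right h0.symm)
    refine (Polynomial.finite_setOfPred_isRoot hQ0).subset fun z hz => ?_
    change Q.eval z = 0
    rw [heval]; exact hz
  set η : ℝ := ε / (4 * (R ^ (N + 4) + 1)) with hη
  have hη0 : 0 < η := by positivity
  obtain ⟨δ, hδ0, hδε, hδ⟩ := exists_small_real_notMem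
    (hzeros.image fun z => -(T z 0 + η * z ^ (N + 4))) (by positivity : 0 < ε / 4)
  set u : ℂ → EuclideanSpace ℂ (Fin (n + 1)) :=
    fun z => T z + EuclideanSpace.single i (δ' : ℂ) with hu
  set q : ℂ → ℂ := fun z => η * z ^ (N + 4) + δ with hq
  set p : ℂ → EuclideanSpace ℂ (Fin (n + 1)) := fun z => u z + EuclideanSpace.single 0 (q z) with hp
  have hpi : ∀ z, p z i = T z i + δ' := by intro z; simp [hp, hu, hi]
  have hu0 : ∀ z, u z 0 = T z 0 := by intro z; simp [hu, hi.symm]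
  have hp0 : ∀ z, p z 0 = T z 0 + η * z ^ (N + 4) + δ := by
    intro z; simp [hp, hu0, hq]; ring
  refine ⟨p, ⟨?_, ?_, ?_⟩, ?_⟩
  · rw [differentiable_euclidean]
    intro l
    simp only [hp, hu, hq, PiLp.add_apply, hTcoord, PiLp.single_apply]
    split_ifs <;> fun_prop
  · intro z hz
    have h1 : T z i + δ' = 0 := by rw [← hpi, hz]; rfl
    refine hδ ⟨z, h1, ?_⟩
    have h0 : T z 0 + η * z ^ (N + 4) + δ = 0 := by rw [← hp0, hz]; rfl
    simp only
    linear_combination -h0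
  · set D : ℝ := ∑ k ∈ Finset.range N, ‖c k‖ + δ' + δ with hD
    have hc0 : 0 ≤ ∑ k ∈ Finset.range N, ‖c k‖ := Finset.sum_nonneg fun _ _ => norm_nonneg _
    have hD0 : 0 ≤ D := by positivity
    refine ⟨2 * D / (η / 2), 1 + 2 * D / η, fun w hw => ?_⟩
    have hDη : 0 ≤ 2 * D / η := by positivity
    have hw1 : 1 ≤ ‖w‖ := by linarith
    have hpow : 1 ≤ ‖w‖ ^ N := one_le_pow₀ hw1
    have hTle : ‖T w‖ ≤ (∑ k ∈ Finset.range N, ‖c k‖) * ‖w‖ ^ N := by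
      rw [Finset.sum_mul]
      refine norm_sum_le_of_le _ fun k hk => ?_
      rw [norm_smul, norm_pow, mul_comm]
      exact mul_le_mul_of_nonneg_left
        (pow_le_pow_right₀ hw1 (Finset.mem_range.1 hk).le) (norm_nonneg _)
    have hule : ‖u w‖ ≤ D * ‖w‖ ^ N := by
      have h1 : ‖u w‖ ≤ ‖T w‖ + δ' := by
        refine (norm_add_le _ _).trans ?_
        simp [abs_of_pos hδ'0]
      nlinarith
    have hTuδ : ‖T w 0 + δ‖ ≤ D * ‖w‖ ^ N := by
      have h1 : ‖T w 0 + (δ : ℂ)‖ ≤ ‖T w‖ + δ := by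
        refine (norm_add_le _ _).trans ?_
        rw [Complex.norm_real, Real.norm_of_nonneg hδ0.le]
        gcongr
        exact PiLp.norm_apply_le _ _
      nlinarith
    have hp0le : η / 2 * ‖w‖ ^ (N + 4) ≤ ‖p w 0‖ := by
      have h1 : ‖(η : ℂ) * w ^ (N + 4)‖ = η * ‖w‖ ^ (N + 4) := by
        rw [norm_mul, norm_pow, Complex.norm_real, Real.norm_of_nonneg hη0.le]
      have h2 : (η : ℂ) * w ^ (N + 4) = p w 0 - (T w 0 + δ) := by rw [hp0]; ring
      have h3 : η * ‖w‖ ^ (N + 4) ≤ ‖p w 0‖ + D * ‖w‖ ^ N := by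
        rw [← h1, h2]
        exact (norm_sub_le _ _).trans (by gcongr)
      have h4 : D ≤ η / 2 * ‖w‖ ^ 4 := by
        have h5 : ‖w‖ ≤ ‖w‖ ^ 4 := le_self_pow₀ hw1 (by norm_num)
        have h6 : 2 * D / η ≤ ‖w‖ ^ 4 := by linarith
        rw [div_le_iff₀ hη0] at h6
        linarith
      have h7 : D * ‖w‖ ^ N ≤ η / 2 * ‖w‖ ^ (N + 4) := by
        calc D * ‖w‖ ^ N ≤ η / 2 * ‖w‖ ^ 4 * ‖w‖ ^ N := by gcongr
          _ = _ := by ring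
      linarith
    have hppos : 0 < ‖p w 0‖ := lt_of_lt_of_le (by positivity) hp0le
    have hpne : p w 0 ≠ 0 := norm_pos_iff.1 hppos
    refine ⟨hpne, ?_⟩
    have haff : affinePart p w = (p w 0)⁻¹ • (u w - EuclideanSpace.single 0 (u w 0)) := by
      have h1 : u w - EuclideanSpace.single 0 (u w 0) =
          p w - (p w 0) • EuclideanSpace.single 0 (1 : ℂ) := by
        ext l
        by_cases hl : l = 0
        · subst hl; simp
        · simp [hp, hl]
      rw [h1, smul_sub, smul_smul, inv_mul_cancel₀ hpne, one_smul, affinePart]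
    rw [haff, norm_smul, norm_inv, inv_mul_eq_div]
    have hnum : ‖u w - EuclideanSpace.single 0 (u w 0)‖ ≤ 2 * D * ‖w‖ ^ N := by
      have h1 : ‖u w 0‖ ≤ ‖u w‖ := PiLp.norm_apply_le _ _
      refine (norm_sub_le _ _).trans ?_
      rw [PiLp.norm_single]
      linarith
    calc _ ≤ 2 * D * ‖w‖ ^ N / (η / 2 * ‖w‖ ^ (N + 4)) := by gcongr
      _ = 2 * D / (η / 2) / ‖w‖ ^ 4 := by
        have : ‖w‖ ≠ 0 := by positivity
        field_simp
        ring
  · intro z hz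
    have hzR : ‖z‖ ≤ R := by simpa using hz
    have h1 : p z - T z = EuclideanSpace.single i (δ' : ℂ) + EuclideanSpace.single 0 (q z) := by
      simp only [hp, hu]; abel
    rw [h1]
    have h2 : ‖q z‖ ≤ ε / 4 + δ := by
      refine (norm_add_le _ _).trans ?_
      rw [norm_mul, norm_pow, Complex.norm_real, Complex.norm_real, Real.norm_of_nonneg hη0.le,
        Real.norm_of_nonneg hδ0.le]
      gcongr
      calc η * ‖z‖ ^ (N + 4) ≤ η * (R ^ (N + 4) + 1) := by
            gcongr
            exact (pow_le_pow_left₀ (norm_nonneg _) hzR _).trans (by linarith)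
        _ = ε / 4 := by rw [hη]; field_simp
    calc _ ≤ ‖EuclideanSpace.single i (δ' : ℂ)‖ + ‖EuclideanSpace.single 0 (q z)‖ :=
          norm_add_le _ _
      _ = δ' + ‖q z‖ := by
          rw [PiLp.norm_single, PiLp.norm_single, Complex.norm_real,
            Real.norm_of_nonneg hδ'0.le]
      _ < ε := by linarith

/-- On a disc, an entire curve has a lift `G` that is bounded away from `0` and is a uniform limit
of blocks. -/
theorem IsEntireCurve.exists_isBlock_approx {n : ℕ} (hn : 1 ≤ n) {g : ℂ → CP n}
    (hg : IsEntireCurve g) {R : ℝ} (hR : 0 ≤ R) :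
    ∃ (G : ℂ → EuclideanSpace ℂ (Fin (n + 1))) (m : ℝ), 0 < m ∧
      (∀ z ∈ Metric.closedBall (0 : ℂ) R, m ≤ ‖G z‖ ∧
        ∃ hz : G z ≠ 0, g z = Projectivization.mk ℂ (G z) hz) ∧
      ∀ ε : ℝ, 0 < ε → ∃ p : ℂ → EuclideanSpace ℂ (Fin (n + 1)), IsBlock p ∧
        ∀ z ∈ Metric.closedBall (0 : ℂ) R, ‖p z - G z‖ < ε := by
  obtain ⟨G, hG⟩ := hg.exists_lift_closedBall (R + 2)
  have hsub : Metric.closedBall (0 : ℂ) R ⊆ Metric.closedBall 0 (R + 2) :=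
    Metric.closedBall_subset_closedBall (by linarith)
  have hdiff : DifferentiableOn ℂ G (Metric.closedBall 0 (R + 2)) :=
    fun z hz => (hG z hz).1.differentiableAt.differentiableWithinAt
  have hGne : ∀ z ∈ Metric.closedBall (0 : ℂ) R,
      ∃ hz : G z ≠ 0, g z = Projectivization.mk ℂ (G z) hz :=
    fun z hz => (hG z (hsub hz)).2.self_of_nhds
  obtain ⟨z₀, hz₀, hmin⟩ := (isCompact_closedBall (0 : ℂ) R).exists_isMinOn
    ⟨0, by simpa using hR⟩ (hdiff.continuousOn.mono hsub).norm
  refine ⟨G, ‖G z₀‖, norm_pos_iff.2 (hGne z₀ hz₀).1, fun z hz => ⟨hmin hz, hGne z hz⟩,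
    fun ε hε => ?_⟩
  obtain ⟨R₁, hR₁⟩ : ∃ x : NNReal, (x : ℝ) = R + 1 := ⟨⟨R + 1, by linarith⟩, rfl⟩
  obtain ⟨R₂, hR₂⟩ : ∃ x : NNReal, (x : ℝ) = R + 2 := ⟨⟨R + 2, by linarith⟩, rfl⟩
  rw [← hR₂] at hdiff
  have hps := DifferentiableOn.hasFPowerSeriesOnBall hdiff
    (by rw [← NNReal.coe_pos, hR₂]; linarith)
  have hlt : (R₁ : ENNReal) < R₂ := by
    rw [ENNReal.coe_lt_coe, ← NNReal.coe_lt_coe, hR₁, hR₂]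
    linarith
  have huni := Metric.tendstoUniformlyOn_iff.1 (hps.tendstoUniformlyOn' hlt) (ε / 2)
    (by positivity)
  obtain ⟨N, hN⟩ := huni.exists
  obtain ⟨p, hp, hpN⟩ := exists_isBlock_near_polynomial hn
    (fun k => (cauchyPowerSeries G 0 R₂).coeff k) N hR (by positivity : 0 < ε / 2)
  refine ⟨p, hp, fun z hz => ?_⟩
  have h1 := hpN z hz
  have h2 := hN z (by
    have : ‖z‖ ≤ R := by simpa using hz
    rw [mem_ball_zero_iff]
    rw [hR₁]
    linarith)
  have h3 : (cauchyPowerSeries G 0 R₂).partialSum N (z - 0) =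
      ∑ k ∈ Finset.range N, z ^ k • (cauchyPowerSeries G 0 R₂).coeff k := by
    rw [sub_zero]
    refine Finset.sum_congr rfl fun k _ => ?_
    exact FormalMultilinearSeries.apply_eq_pow_smul_coeff
  have h4 : ‖G z - ∑ k ∈ Finset.range N, z ^ k • (cauchyPowerSeries G 0 R₂).coeff k‖
      < ε / 2 := by
    rw [← h3, ← dist_eq_norm]
    exact h2
  calc ‖p z - G z‖ ≤ _ := norm_sub_le_norm_sub_add_norm_sub _
        (∑ k ∈ Finset.range N, z ^ k • (cauchyPowerSeries G 0 R₂).coeff k) _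
    _ < ε := by rw [norm_sub_rev _ (G z)]; linarith

theorem exists_seq_subset_closure {Y : Type*} [TopologicalSpace Y] [SecondCountableTopology Y]
    (s : Set Y) (hs : s.Nonempty) : ∃ u : ℕ → Y, (∀ k, u k ∈ s) ∧ s ⊆ closure (Set.range u) := by
  have : Nonempty s := hs.to_subtype
  refine ⟨fun k => TopologicalSpace.denseSeq s k, fun k => (TopologicalSpace.denseSeq s k).2,
    fun y hy => ?_⟩
  have h := TopologicalSpace.denseRange_denseSeq s ⟨y, hy⟩
  rw [closure_subtype, ← Set.range_comp] at h
  exact h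

theorem exists_dense_seq_isBlock {n : ℕ} (hn : 1 ≤ n) :
    ∃ p : ℕ → ℂ → EuclideanSpace ℂ (Fin (n + 1)), (∀ k, IsBlock (p k)) ∧
      ∀ q : ℂ → EuclideanSpace ℂ (Fin (n + 1)), IsBlock q → ∀ R ε : ℝ, 0 < ε →
        ∃ k, ∀ z ∈ Metric.closedBall (0 : ℂ) R, ‖p k z - q z‖ < ε := by
  obtain ⟨q₀, hq₀, -⟩ := exists_isBlock_near_polynomial hn 0 0 le_rfl one_pos
  obtain ⟨u, hu, hdense⟩ := exists_seq_subset_closure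
    {f : C(ℂ, EuclideanSpace ℂ (Fin (n + 1))) | IsBlock f}
    ⟨⟨q₀, hq₀.differentiable.continuous⟩, hq₀⟩
  refine ⟨fun k => u k, hu, fun q hq R ε hε => ?_⟩
  have hunif := ContinuousMap.tendsto_iff_forall_isCompact_tendstoUniformlyOn.1
    (Filter.tendsto_id (x := 𝓝 (⟨q, hq.differentiable.continuous⟩ :
      C(ℂ, EuclideanSpace ℂ (Fin (n + 1)))))) _ (isCompact_closedBall (0 : ℂ) R)
  have hev := Metric.tendstoUniformlyOn_iff.1 hunif ε hε
  obtain ⟨_, hy, k, rfl⟩ := mem_closure_iff_nhds.1 (hdense hq) _ hev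
  refine ⟨k, fun z hz => ?_⟩
  rw [norm_sub_rev, ← dist_eq_norm]
  exact hy z hz

/-- The decay `O(|w|⁻⁴)` of the affine coordinates passes to their derivative by Cauchy's estimate
on unit discs. The exponent `-3` leaves a factor that is small near infinity, and still gives an
integrable function on the plane. -/
theorem IsBlock.exists_affinePart_le {n : ℕ} {p : ℂ → EuclideanSpace ℂ (Fin (n + 1))}
    (hp : IsBlock p) {ε : ℝ} (hε : 0 < ε) :
    ∃ ρ₀ : ℝ, ∀ w : ℂ, ρ₀ ≤ ‖w‖ → p w 0 ≠ 0 ∧ ‖affinePart p w‖ ≤ ε * (1 + ‖w‖) ^ (-3 : ℝ) ∧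
      ‖deriv (affinePart p) w‖ ≤ ε * (1 + ‖w‖) ^ (-3 : ℝ) := by
  obtain ⟨C, ρ, hC⟩ := hp.decay
  refine ⟨max (ρ + 1) (max 2 (128 * |C| / ε)), fun w hw => ?_⟩
  have hw1 : ρ + 1 ≤ ‖w‖ := (le_max_left _ _).trans hw
  have hw2 : 2 ≤ ‖w‖ := ((le_max_left _ _).trans (le_max_right _ _)).trans hw
  have hw3 : 128 * |C| / ε ≤ ‖w‖ := ((le_max_right _ _).trans (le_max_right _ _)).trans hw
  have hw0 : 0 < ‖w‖ := by linarith
  have hkey : 16 * |C| / ‖w‖ ^ 4 ≤ ε * (1 + ‖w‖) ^ (-3 : ℝ) := by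
    rw [Real.rpow_neg (by positivity), show (3 : ℝ) = ((3 : ℕ) : ℝ) by norm_num, Real.rpow_natCast,
      ← div_eq_mul_inv, div_le_div_iff₀ (by positivity) (by positivity)]
    rw [div_le_iff₀ hε] at hw3
    calc 16 * |C| * (1 + ‖w‖) ^ 3 ≤ 16 * |C| * (2 * ‖w‖) ^ 3 := by gcongr; linarith
      _ = (128 * |C|) * ‖w‖ ^ 3 := by ring
      _ ≤ (‖w‖ * ε) * ‖w‖ ^ 3 := by gcongr
      _ = _ := by ring
  refine ⟨(hC w (by linarith)).1, ?_, ?_⟩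
  · refine (hC w (by linarith)).2.trans (le_trans ?_ hkey)
    gcongr
    linarith [le_abs_self C, abs_nonneg C]
  · have hnorm : ∀ u ∈ Metric.closedBall w 1, ‖w‖ - 1 ≤ ‖u‖ := by
      intro u hu
      rw [mem_closedBall_iff_norm'] at hu
      linarith [norm_sub_norm_le w u]
    have hd : ∀ u ∈ Metric.closedBall w 1, DifferentiableAt ℂ (affinePart p) u := by
      intro u hu
      exact differentiableAt_affinePart (hp.differentiable u) (hC u (by linarith [hnorm u hu])).1
    have hcl : DiffContOnCl ℂ (affinePart p) (Metric.ball w 1) := by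
      refine DifferentiableOn.diffContOnCl fun u hu => ?_
      rw [closure_ball w one_ne_zero] at hu
      exact (hd u hu).differentiableWithinAt
    have h := Complex.norm_deriv_le_of_forall_mem_sphere_norm_le (C := 16 * |C| / ‖w‖ ^ 4)
      one_pos hcl fun u hu => ?_
    · rw [div_one] at h
      exact h.trans hkey
    · have hu' := hnorm u (Metric.sphere_subset_closedBall hu)
      refine (hC u (by linarith)).2.trans ?_
      have hu2 : ‖w‖ / 2 ≤ ‖u‖ := by linarith
      calc C / ‖u‖ ^ 4 ≤ |C| / (‖w‖ / 2) ^ 4 := by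
            gcongr
            exact le_abs_self C
        _ = 16 * |C| / ‖w‖ ^ 4 := by field_simp; ring

/-! ### Superposition of translated blocks -/

/-- A sequence of blocks `p j`, to be translated to centres `a j`, with the quantitative data that
make their superposition converge. -/
structure Arrangement (n : ℕ) where
  /-- The blocks. -/
  p : ℕ → ℂ → EuclideanSpace ℂ (Fin (n + 1))
  /-- The centres. -/
  a : ℕ → ℂ
  /-- The radii of the discs around the centres. -/
  ρ : ℕ → ℝ
  /-- The tolerance of the `j`-th block for perturbations of its affine coordinates. -/
  δ : ℕ → ℝ
  /-- A bound for the area density on the `j`-th disc. -/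
  b : ℕ → ℝ
  /-- A bound for the affine coordinates off the discs. -/
  ε : ℝ
  isBlock : ∀ j, IsBlock (p j)
  /-- Off its disc, the `j`-th block is small together with its derivative. -/
  far : ∀ j w, ρ j ≤ ‖w‖ → p j w 0 ≠ 0 ∧
    ‖affinePart (p j) w‖ ≤ ε / 2 / 2 ^ j * (1 + ‖w‖) ^ (-3 : ℝ) ∧
    ‖deriv (affinePart (p j)) w‖ ≤ ε / 2 / 2 ^ j * (1 + ‖w‖) ^ (-3 : ℝ)
  ρ_nonneg : ∀ j, 0 ≤ ρ j
  δ_pos : ∀ j, 0 < δ j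
  b_nonneg : ∀ j, 0 ≤ b j
  /-- The expression is `‖F'‖² / ‖F‖²` for the perturbed block `F = p + p₀ • s`. -/
  density_le : ∀ j w, ‖w‖ ≤ ρ j → ∀ s s' : EuclideanSpace ℂ (Fin (n + 1)),
    ‖s‖ ≤ δ j → ‖s'‖ ≤ δ j →
    ‖deriv (p j) w + (p j w 0 • s' + (deriv (p j) w) 0 • s)‖ ^ 2 /
      ‖p j w + p j w 0 • s‖ ^ 2 ≤ b j
  ε_pos : 0 < ε
  ε_le : ε ≤ 1
  /-- The term `(δ i)⁻¹` keeps the other blocks below the tolerance `δ i` on the `i`-th disc. -/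
  sep : ∀ i j, i ≠ j → ρ i + ρ j + (δ i)⁻¹ ≤ ‖a i - a j‖
  escape : ∀ j, j + ρ j ≤ ‖a j‖

namespace Arrangement

variable {n : ℕ} (A : Arrangement n)

/-- The points outside all the discs (for `o = none`), or outside all the discs but the `i`-th (for
`o = some i`). -/
def region (o : Option ℕ) : Set ℂ := {z | ∀ j, o ≠ some j → A.ρ j < ‖z - A.a j‖}

/-- The bound for the `j`-th translated block and its derivative off the `j`-th disc. -/
noncomputable def weight (j : ℕ) (z : ℂ) : ℝ :=
  A.ε / 2 / 2 ^ j * (1 + ‖z - A.a j‖) ^ (-3 : ℝ)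

/-- The affine coordinates of the `j`-th translated block, replaced by `0` if `o = some j`. -/
noncomputable def term (o : Option ℕ) (j : ℕ) (z : ℂ) : EuclideanSpace ℂ (Fin (n + 1)) :=
  if o = some j then 0 else affinePart (A.p j) (z - A.a j)

/-- The sum of the affine coordinates of all the translated blocks (for `o = none`), or of all but
the `i`-th (for `o = some i`). -/
noncomputable def rest (o : Option ℕ) (z : ℂ) : EuclideanSpace ℂ (Fin (n + 1)) :=
  ∑' j, A.term o j z

/-- The lift of the curve that is used on `A.region o`. For `o = some i` the denominator of the
`i`-th block is cleared, so that the zeros of `p i · 0` do no harm. -/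
noncomputable def lift : Option ℕ → ℂ → EuclideanSpace ℂ (Fin (n + 1))
  | none, z => EuclideanSpace.single 0 1 + A.rest none z
  | some i, z => A.p i (z - A.a i) + A.p i (z - A.a i) 0 • A.rest (some i) z

/-- The discs escape to infinity, so only finitely many of them come near a given point. -/
theorem isOpen_region (o : Option ℕ) : IsOpen (A.region o) := by
  rw [isOpen_iff_mem_nhds]
  intro z hz
  obtain ⟨N, hN⟩ := exists_nat_gt (‖z‖ + 1)
  have h1 : ∀ᶠ w in 𝓝 z, ∀ j ∈ Finset.range N, o ≠ some j → A.ρ j < ‖w - A.a j‖ := by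
    rw [Filter.eventually_all_finset]
    intro j _
    by_cases hj : o = some j
    · simp [hj]
    · have hc : ContinuousAt (fun w => ‖w - A.a j‖) z := by fun_prop
      filter_upwards [hc.eventually_const_lt (hz j hj)] with w hw _ using hw
  have h2 : ∀ᶠ w in 𝓝 z, ‖w‖ < ‖z‖ + 1 :=
    continuous_norm.continuousAt.eventually_lt_const (by linarith)
  filter_upwards [h1, h2] with w hw1 hw2 j hj
  by_cases hjN : j < N
  · exact hw1 j (Finset.mem_range.2 hjN) hj
  · have h3 : (N : ℝ) ≤ j := by exact_mod_cast not_lt.1 hjN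
    have h4 := A.escape j
    have h5 := norm_sub_norm_le (A.a j) w
    rw [norm_sub_rev] at h5
    linarith

theorem mem_region_some {i : ℕ} {z : ℂ} (hz : ‖z - A.a i‖ ≤ A.ρ i) :
    z ∈ A.region (some i) := by
  intro j hj
  have hij : i ≠ j := fun h => hj (by rw [h])
  have h1 := A.sep i j hij
  have h2 := inv_pos.2 (A.δ_pos i)
  have h3 := norm_sub_le_norm_sub_add_norm_sub (A.a i) z (A.a j)
  rw [norm_sub_rev (A.a i) z] at h3
  linarith

theorem one_add_norm_rpow_le_one (w : ℂ) : (1 + ‖w‖) ^ (-3 : ℝ) ≤ 1 :=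
  Real.rpow_le_one_of_one_le_of_nonpos (by linarith [norm_nonneg w]) (by norm_num)

theorem weight_nonneg (j : ℕ) (z : ℂ) : 0 ≤ A.weight j z := by
  have := A.ε_pos.le
  unfold weight
  positivity

theorem weight_le (j : ℕ) (z : ℂ) : A.weight j z ≤ A.ε / 2 / 2 ^ j := by
  have := A.ε_pos.le
  exact mul_le_of_le_one_right (by positivity) (one_add_norm_rpow_le_one _)

theorem summable_weight (z : ℂ) : Summable fun j => A.weight j z :=
  (hasSum_geometric_two' A.ε).summable.of_nonneg_of_le (fun j => A.weight_nonneg j z)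
    fun j => A.weight_le j z

theorem norm_term_le {o : Option ℕ} {z : ℂ} (hz : z ∈ A.region o) (j : ℕ) :
    ‖A.term o j z‖ ≤ A.weight j z := by
  unfold term
  split_ifs with h
  · simpa using A.weight_nonneg j z
  · exact (A.far j _ (hz j h).le).2.1

theorem norm_deriv_term_le {o : Option ℕ} {z : ℂ} (hz : z ∈ A.region o) (j : ℕ) :
    ‖deriv (A.term o j) z‖ ≤ A.weight j z := by
  by_cases h : o = some j
  · have : A.term o j = fun _ => 0 := by funext w; simp [term, h]
    simpa [this] using A.weight_nonneg j z
  · have : A.term o j = fun w => affinePart (A.p j) (w - A.a j) := by funext w; simp [term, h]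
    rw [this, deriv_comp_sub_const]
    exact (A.far j _ (hz j h).le).2.2

theorem differentiableOn_term (o : Option ℕ) (j : ℕ) :
    DifferentiableOn ℂ (A.term o j) (A.region o) := by
  intro z hz
  refine DifferentiableAt.differentiableWithinAt ?_
  by_cases h : o = some j
  · have : A.term o j = fun _ => 0 := by funext w; simp [term, h]
    rw [this]
    exact differentiableAt_const _
  · have : A.term o j = fun w => affinePart (A.p j) (w - A.a j) := by funext w; simp [term, h]
    rw [this]
    exact differentiableAt_comp_sub_const.2 (differentiableAt_affinePart
      ((A.isBlock j).differentiable _) (A.far j _ (hz j h).le).1)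

theorem differentiableOn_rest (o : Option ℕ) : DifferentiableOn ℂ (A.rest o) (A.region o) :=
  Complex.differentiableOn_tsum_of_summable_norm (hasSum_geometric_two' A.ε).summable
    (A.differentiableOn_term o) (A.isOpen_region o)
    fun j w hw => (A.norm_term_le hw j).trans (A.weight_le j w)

theorem hasSum_deriv_term {o : Option ℕ} {z : ℂ} (hz : z ∈ A.region o) :
    HasSum (fun j => deriv (A.term o j) z) (deriv (A.rest o) z) :=
  Complex.hasSum_deriv_of_summable_norm (hasSum_geometric_two' A.ε).summable
    (A.differentiableOn_term o) (A.isOpen_region o)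
    (fun j w hw => (A.norm_term_le hw j).trans (A.weight_le j w)) hz

theorem rest_apply_zero {o : Option ℕ} {z : ℂ} (hz : z ∈ A.region o) : A.rest o z 0 = 0 := by
  have hs : Summable fun j => A.term o j z :=
    (A.summable_weight z).of_norm_bounded (A.norm_term_le hz)
  have h := (EuclideanSpace.proj (𝕜 := ℂ) (0 : Fin (n + 1))).map_tsum hs
  change A.rest o z 0 = _ at h
  rw [h]
  refine (tsum_congr fun j => ?_).trans tsum_zero
  change A.term o j z 0 = 0
  unfold term
  split_ifs with hj
  · rfl
  · simp [affinePart, inv_mul_cancel₀ (A.far j _ (hz j hj).le).1]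

/-- Termwise bounds for `A.rest o` hold for its derivative too, as `far` bounds the derivatives of
the terms by the same weights. -/
theorem norm_rest_le {o : Option ℕ} {z : ℂ} (hz : z ∈ A.region o) {u : ℕ → ℝ} {C : ℝ}
    (hu : HasSum u C) (hu0 : ∀ j, 0 ≤ u j) (h : ∀ j, o ≠ some j → A.weight j z ≤ u j) :
    ‖A.rest o z‖ ≤ C ∧ ‖deriv (A.rest o) z‖ ≤ C := by
  constructor
  · refine tsum_of_norm_bounded hu fun j => ?_
    by_cases hj : o = some j
    · simpa [term, hj] using hu0 j
    · exact (A.norm_term_le hz j).trans (h j hj)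
  · rw [← (A.hasSum_deriv_term hz).tsum_eq]
    refine tsum_of_norm_bounded hu fun j => ?_
    by_cases hj : o = some j
    · have : A.term o j = fun _ => 0 := by funext w; simp [term, hj]
      simpa [this] using hu0 j
    · exact (A.norm_deriv_term_le hz j).trans (h j hj)

theorem norm_rest_some_le {i : ℕ} {z : ℂ} (hz : ‖z - A.a i‖ ≤ A.ρ i) :
    ‖A.rest (some i) z‖ ≤ A.δ i ∧ ‖deriv (A.rest (some i)) z‖ ≤ A.δ i := by
  have hδ := A.δ_pos i
  refine A.norm_rest_le (A.mem_region_some hz) (hasSum_geometric_two' (A.δ i))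
    (fun j => by positivity) fun j hj => ?_
  have hij : i ≠ j := fun h => hj (by rw [h])
  have h1 := A.sep i j hij
  have h3 := norm_sub_le_norm_sub_add_norm_sub (A.a i) z (A.a j)
  rw [norm_sub_rev (A.a i) z] at h3
  have h4 : (A.δ i)⁻¹ ≤ 1 + ‖z - A.a j‖ := by linarith [A.ρ_nonneg j]
  have h5 : (1 + ‖z - A.a j‖) ^ (-3 : ℝ) ≤ A.δ i := by
    calc (1 + ‖z - A.a j‖) ^ (-3 : ℝ) ≤ (1 + ‖z - A.a j‖) ^ (-1 : ℝ) :=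
          Real.rpow_le_rpow_of_exponent_le (by linarith [norm_nonneg (z - A.a j)]) (by norm_num)
      _ = (1 + ‖z - A.a j‖)⁻¹ := Real.rpow_neg_one _
      _ ≤ A.δ i := inv_le_of_inv_le₀ hδ h4
  have hε := A.ε_pos.le
  have hε1 := A.ε_le
  calc A.weight j z ≤ 1 / 2 / 2 ^ j * A.δ i := by unfold weight; gcongr
    _ = A.δ i / 2 / 2 ^ j := by ring

theorem lift_some_eq_smul {i : ℕ} {z : ℂ} (hz : z ∈ A.region none) :
    A.lift (some i) z = A.p i (z - A.a i) 0 • A.lift none z := by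
  have hs : Summable fun j => A.term none j z :=
    (A.summable_weight z).of_norm_bounded (A.norm_term_le hz)
  have h0 := (A.far i _ (hz i (by simp)).le).1
  have h1 : A.rest none z = affinePart (A.p i) (z - A.a i) + A.rest (some i) z := by
    unfold rest
    rw [hs.tsum_eq_add_tsum_ite i]
    congr 1
    refine tsum_congr fun j => ?_
    by_cases hj : j = i
    · simp [term, hj]
    · simp [term, hj, Ne.symm hj]
  simp only [lift]
  rw [h1, affinePart, ← add_assoc, add_sub_cancel, smul_add, smul_smul, mul_inv_cancel₀ h0,
    one_smul]

theorem one_le_norm_lift_none {z : ℂ} (hz : z ∈ A.region none) : 1 ≤ ‖A.lift none z‖ := by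
  have h : A.lift none z 0 = 1 := by simp [lift, A.rest_apply_zero hz]
  calc (1 : ℝ) = ‖A.lift none z 0‖ := by rw [h, norm_one]
    _ ≤ _ := PiLp.norm_apply_le _ _

theorem lift_ne_zero {o : Option ℕ} {z : ℂ} (hz : z ∈ A.region o) : A.lift o z ≠ 0 := by
  rcases o with _ | i
  · exact norm_pos_iff.1 (one_pos.trans_le (A.one_le_norm_lift_none hz))
  · intro h
    have h0 : A.p i (z - A.a i) 0 = 0 := by
      have : A.lift (some i) z 0 = 0 := by rw [h]; rfl
      simpa [lift, A.rest_apply_zero hz] using this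
    refine (A.isBlock i).ne_zero (z - A.a i) ?_
    simpa [lift, h0] using h

open Classical in
/-- The index of the disc that contains `z`, if there is one. -/
noncomputable def index (z : ℂ) : Option ℕ :=
  if h : ∃ i, ‖z - A.a i‖ ≤ A.ρ i then some h.choose else none

theorem mem_region_index (z : ℂ) : z ∈ A.region (A.index z) := by
  unfold index
  split_ifs with h
  · exact A.mem_region_some h.choose_spec
  · push Not at h
    exact fun j _ => h j

/-- The superposition of the translated blocks. On `A.region o` it is the curve with lift
`A.lift o`, see `curve_eq`. -/
noncomputable def curve (z : ℂ) : CP n :=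
  Projectivization.mk ℂ (A.lift (A.index z) z) (A.lift_ne_zero (A.mem_region_index z))

theorem index_eq_or_mem_region_none {o : Option ℕ} {z : ℂ} (hz : z ∈ A.region o) :
    A.index z = o ∨ z ∈ A.region none := by
  by_cases h : ∃ i, ‖z - A.a i‖ ≤ A.ρ i
  · left
    rw [index, dif_pos h]
    by_contra hne
    exact absurd h.choose_spec (not_le.2 (hz _ (Ne.symm hne)))
  · right
    push Not at h
    exact fun j _ => h j

theorem mk_lift_eq_of_mem_region_none {o : Option ℕ} {z : ℂ} (hz : z ∈ A.region none)
    (h : A.lift o z ≠ 0) : Projectivization.mk ℂ (A.lift o z) h =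
      Projectivization.mk ℂ (A.lift none z) (A.lift_ne_zero hz) := by
  rcases o with _ | i
  · rfl
  · exact (Projectivization.mk_eq_mk_iff' ℂ _ _ _ _).2 ⟨_, (A.lift_some_eq_smul hz).symm⟩

theorem curve_eq {o : Option ℕ} {z : ℂ} (hz : z ∈ A.region o) :
    A.curve z = Projectivization.mk ℂ (A.lift o z) (A.lift_ne_zero hz) := by
  rcases A.index_eq_or_mem_region_none hz with h | h
  · subst h; rfl
  · rw [curve, A.mk_lift_eq_of_mem_region_none h]
    exact (A.mk_lift_eq_of_mem_region_none h _).symm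

theorem differentiableOn_lift (o : Option ℕ) : DifferentiableOn ℂ (A.lift o) (A.region o) := by
  rcases o with _ | i
  · exact (A.differentiableOn_rest none).const_add _
  · have h : Differentiable ℂ fun z => A.p i (z - A.a i) :=
      (A.isBlock i).differentiable.comp (differentiable_id.sub_const _)
    exact h.differentiableOn.add
      ((differentiable_euclidean.1 h 0).differentiableOn.smul (A.differentiableOn_rest _))

theorem isLocalLift_lift {o : Option ℕ} {z : ℂ} (hz : z ∈ A.region o) :
    IsLocalLift (A.lift o) A.curve z := by
  have hnhds := (A.isOpen_region o).mem_nhds hz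
  refine ⟨(A.differentiableOn_lift o).analyticAt hnhds, ?_⟩
  filter_upwards [hnhds] with w hw
  exact ⟨A.lift_ne_zero hw, A.curve_eq hw⟩

theorem isEntireCurve_curve : IsEntireCurve A.curve :=
  fun z => ⟨_, A.isLocalLift_lift (A.mem_region_index z)⟩

theorem norm_lift_sub_le {i : ℕ} {z : ℂ} (hz : ‖z‖ ≤ A.ρ i) :
    ‖A.lift (some i) (z + A.a i) - A.p i z‖ ≤ ‖A.p i z 0‖ * A.δ i := by
  simp only [lift, add_sub_cancel_right, add_sub_cancel_left]
  rw [norm_smul]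
  exact mul_le_mul_of_nonneg_left
    (A.norm_rest_some_le (by rwa [add_sub_cancel_right])).1 (norm_nonneg _)

theorem pullbackFS_le_of_mem_disc {i : ℕ} {z : ℂ} (hz : ‖z - A.a i‖ ≤ A.ρ i) :
    pullbackFS A.curve z ≤ A.b i := by
  have hreg := A.mem_region_some hz
  refine (pullbackFS_le (A.isLocalLift_lift hreg)).trans ?_
  have hp : HasDerivAt (fun w => A.p i (w - A.a i)) (deriv (A.p i) (z - A.a i)) z :=
    ((A.isBlock i).differentiable _).hasDerivAt.comp_sub_const z (A.a i)
  have hp0 : HasDerivAt (fun w => A.p i (w - A.a i) 0) (deriv (A.p i) (z - A.a i) 0) z :=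
    (EuclideanSpace.proj (𝕜 := ℂ) (0 : Fin (n + 1))).hasFDerivAt.comp_hasDerivAt z hp
  have hr : HasDerivAt (A.rest (some i)) (deriv (A.rest (some i)) z) z :=
    ((A.differentiableOn_rest _).differentiableAt
      ((A.isOpen_region _).mem_nhds hreg)).hasDerivAt
  have hd : deriv (A.lift (some i)) z = _ := (hp.add (hp0.smul hr)).deriv
  rw [hd]
  exact A.density_le i _ hz _ _ (A.norm_rest_some_le hz).1 (A.norm_rest_some_le hz).2

theorem pullbackFS_le_of_mem_region_none {z : ℂ} (hz : z ∈ A.region none) :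
    pullbackFS A.curve z ≤ A.ε * ∑' j, A.weight j z := by
  refine (pullbackFS_le (A.isLocalLift_lift hz)).trans ?_
  have h1 := A.one_le_norm_lift_none hz
  have hd : deriv (A.lift none) z = deriv (A.rest none) z := by
    change deriv (fun w => EuclideanSpace.single 0 1 + A.rest none w) z = _
    rw [deriv_const_add]
  have hV := A.summable_weight z
  have hrest := (A.norm_rest_le hz hV.hasSum (fun j => A.weight_nonneg j z) fun j _ => le_rfl).2
  have hVε : ∑' j, A.weight j z ≤ A.ε :=
    (hV.tsum_le_tsum (fun j => A.weight_le j z) (hasSum_geometric_two' A.ε).summable).trans_eq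
      (hasSum_geometric_two' A.ε).tsum_eq
  have hV0 : 0 ≤ ∑' j, A.weight j z := tsum_nonneg fun j => A.weight_nonneg j z
  calc ‖deriv (A.lift none) z‖ ^ 2 / ‖A.lift none z‖ ^ 2 ≤ ‖deriv (A.lift none) z‖ ^ 2 :=
        div_le_self (by positivity) (one_le_pow₀ h1)
    _ ≤ (∑' j, A.weight j z) ^ 2 := by rw [hd]; gcongr
    _ ≤ _ := by rw [sq]; gcongr

theorem integrable_one_add_norm_rpow : Integrable fun w : ℂ => (1 + ‖w‖) ^ (-3 : ℝ) :=
  integrable_one_add_norm (by rw [Complex.finrank_real_complex]; norm_num)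

theorem integral_weight (j : ℕ) :
    ∫ z, A.weight j z = A.ε / 2 / 2 ^ j * ∫ w : ℂ, (1 + ‖w‖) ^ (-3 : ℝ) := by
  unfold weight
  rw [integral_const_mul, integral_sub_right_eq_self (fun w : ℂ => (1 + ‖w‖) ^ (-3 : ℝ))]

theorem integrable_weight (j : ℕ) : Integrable (A.weight j) :=
  (integrable_one_add_norm_rpow.comp_sub_right (A.a j)).const_mul _

theorem integrable_tsum_weight : Integrable (fun z => ∑' j, A.weight j z) ∧
    ∫ z, ∑' j, A.weight j z = A.ε * ∫ w : ℂ, (1 + ‖w‖) ^ (-3 : ℝ) := by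
  have hsum : HasSum (fun j => ∫ z, A.weight j z) (A.ε * ∫ w : ℂ, (1 + ‖w‖) ^ (-3 : ℝ)) := by
    simp only [integral_weight]
    exact (hasSum_geometric_two' A.ε).mul_right _
  have hnorm : ∀ j, ∫ z, ‖A.weight j z‖ = ∫ z, A.weight j z := fun j => by
    simp only [Real.norm_of_nonneg (A.weight_nonneg j _)]
  have hint : ∫ z, ∑' j, A.weight j z = A.ε * ∫ w : ℂ, (1 + ‖w‖) ^ (-3 : ℝ) := by
    rw [← integral_tsum_of_summable_integral_norm A.integrable_weight
      (by simpa only [hnorm] using hsum.summable), hsum.tsum_eq]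
  refine ⟨?_, hint⟩
  have hpos : 0 < ∫ w : ℂ, (1 + ‖w‖) ^ (-3 : ℝ) := by
    have hpos' : ∀ w : ℂ, 0 < (1 + ‖w‖) ^ (-3 : ℝ) := fun w => by positivity
    rw [integral_pos_iff_support_of_nonneg (fun w => (hpos' w).le) integrable_one_add_norm_rpow,
      Function.support_eq_univ fun w => (hpos' w).ne']
    exact Measure.measure_univ_pos.2 (NeZero.ne _)
  -- A function with a nonzero Bochner integral is integrable.
  exact not_imp_comm.1 integral_undef (by rw [hint]; exact (mul_pos A.ε_pos hpos).ne')

/-- The area over `|z| < t` is at most a small constant plus the contributions of the discs that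
meet `|z| < r`, and this bound does not involve the centres. -/
theorem integral_pullbackFS_le {r : ℝ} (N : Finset ℕ)
    (hN : ∀ i, ‖A.a i‖ - A.ρ i < r → i ∈ N) {t : ℝ} (ht : t ≤ r) :
    ∫ z in Metric.ball (0 : ℂ) t, pullbackFS A.curve z ≤
      A.ε * (A.ε * ∫ w : ℂ, (1 + ‖w‖) ^ (-3 : ℝ)) +
        ∑ i ∈ N, volume.real (Metric.closedBall (0 : ℂ) (A.ρ i)) * A.b i := by
  have hε := A.ε_pos.le
  have hV0 : ∀ z, 0 ≤ ∑' j, A.weight j z := fun z => tsum_nonneg fun j => A.weight_nonneg j z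
  set Φ : ℂ → ℝ := fun z => A.ε * ∑' j, A.weight j z +
    ∑ i ∈ N, (Metric.closedBall (A.a i) (A.ρ i)).indicator (fun _ => A.b i) z with hΦ
  have hind0 : ∀ i z, 0 ≤ (Metric.closedBall (A.a i) (A.ρ i)).indicator (fun _ => A.b i) z :=
    fun i z => Set.indicator_nonneg (fun _ _ => A.b_nonneg i) z
  have hindI : ∀ i, Integrable ((Metric.closedBall (A.a i) (A.ρ i)).indicator fun _ => A.b i) :=
    fun i => (integrableOn_const measure_closedBall_lt_top.ne).integrable_indicator
      measurableSet_closedBall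
  have hΦint : Integrable Φ :=
    (A.integrable_tsum_weight.1.const_mul _).add (integrable_finsetSum _ fun i _ => hindI i)
  have hΦ0 : ∀ z, 0 ≤ Φ z := fun z =>
    add_nonneg (mul_nonneg hε (hV0 z)) (Finset.sum_nonneg fun i _ => hind0 i z)
  calc ∫ z in Metric.ball (0 : ℂ) t, pullbackFS A.curve z ≤ ∫ z in Metric.ball (0 : ℂ) t, Φ z := by
        refine integral_mono_of_nonneg (Eventually.of_forall fun z => pullbackFS_nonneg _ z)
          hΦint.integrableOn ?_
        filter_upwards [ae_restrict_mem Metric.isOpen_ball.measurableSet] with z hz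
        by_cases h : ∃ i, ‖z - A.a i‖ ≤ A.ρ i
        · obtain ⟨i, hi⟩ := h
          have hiN : i ∈ N := hN i (by
            have h1 : ‖z‖ < t := by simpa using hz
            have h2 := norm_sub_norm_le (A.a i) z
            rw [norm_sub_rev] at h2
            linarith)
          have hmem : z ∈ Metric.closedBall (A.a i) (A.ρ i) := by
            rwa [mem_closedBall_iff_norm]
          calc pullbackFS A.curve z ≤ A.b i := A.pullbackFS_le_of_mem_disc hi
            _ = (Metric.closedBall (A.a i) (A.ρ i)).indicator (fun _ => A.b i) z :=
              (Set.indicator_of_mem hmem fun _ => A.b i).symm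
            _ ≤ ∑ i ∈ N, (Metric.closedBall (A.a i) (A.ρ i)).indicator (fun _ => A.b i) z :=
              Finset.single_le_sum (fun i _ => hind0 i z) hiN
            _ ≤ Φ z := le_add_of_nonneg_left (mul_nonneg hε (hV0 z))
        · push Not at h
          exact (A.pullbackFS_le_of_mem_region_none fun j _ => h j).trans
            (le_add_of_nonneg_right (Finset.sum_nonneg fun i _ => hind0 i z))
    _ ≤ ∫ z, Φ z := setIntegral_le_integral hΦint (Eventually.of_forall hΦ0)
    _ = _ := by
        rw [hΦ, integral_add (A.integrable_tsum_weight.1.const_mul _)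
          (integrable_finsetSum _ fun i _ => hindI i), integral_const_mul,
          A.integrable_tsum_weight.2, integral_finsetSum _ fun i _ => hindI i]
        congr 1
        refine Finset.sum_congr rfl fun i _ => ?_
        rw [integral_indicator_const _ measurableSet_closedBall, smul_eq_mul,
          measureReal_def, measureReal_def, Measure.addHaar_closedBall_center]

end Arrangement

/-! ### Universality and growth -/

theorem exists_pos_le_of_tendsto_atTop {φ : ℝ → ℝ} (hcont : ContinuousOn φ (Set.Ioi 0))
    (hpos : ∀ r : ℝ, 0 < r → 0 < φ r) (hlim : Tendsto φ atTop atTop) :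
    ∃ c : ℝ, 0 < c ∧ ∀ r : ℝ, 1 ≤ r → c ≤ φ r := by
  obtain ⟨R, hR⟩ := eventually_atTop.1 (hlim.eventually_ge_atTop 1)
  obtain ⟨x, hx, hmin⟩ := (isCompact_Icc (a := (1 : ℝ)) (b := max 1 R)).exists_isMinOn
    (Set.nonempty_Icc.2 (le_max_left _ _))
    (hcont.mono fun t ht => Set.mem_Ioi.2 (one_pos.trans_le ht.1))
  refine ⟨min 1 (φ x), lt_min one_pos (hpos x (one_pos.trans_le hx.1)), fun r hr => ?_⟩
  rcases le_total r (max 1 R) with h | h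
  · exact (min_le_right _ _).trans (hmin ⟨hr, h⟩)
  · exact (min_le_left _ _).trans (hR r ((le_max_right _ _).trans h))

/-- On a disc, the area density of a block stays bounded under small perturbations of its affine
coordinates. -/
theorem IsBlock.exists_density_le {n : ℕ} {p : ℂ → EuclideanSpace ℂ (Fin (n + 1))}
    (hp : IsBlock p) {ρ κ : ℝ} (hρ : 0 ≤ ρ) (hκ : 0 < κ) :
    ∃ δ b : ℝ, 0 < δ ∧ 0 ≤ b ∧ (∀ w, ‖w‖ ≤ ρ → ‖p w 0‖ * δ ≤ κ) ∧
      ∀ w, ‖w‖ ≤ ρ → ∀ s s' : EuclideanSpace ℂ (Fin (n + 1)), ‖s‖ ≤ δ → ‖s'‖ ≤ δ →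
        ‖deriv p w + (p w 0 • s' + (deriv p w) 0 • s)‖ ^ 2 / ‖p w + p w 0 • s‖ ^ 2 ≤ b := by
  have hK : IsCompact (Metric.closedBall (0 : ℂ) ρ) := isCompact_closedBall _ _
  have hmem : ∀ w : ℂ, ‖w‖ ≤ ρ ↔ w ∈ Metric.closedBall (0 : ℂ) ρ := by simp
  obtain ⟨w₀, -, hmin⟩ := hK.exists_isMinOn ⟨0, by simpa using hρ⟩
    hp.differentiable.continuous.norm.continuousOn
  obtain ⟨M, hM⟩ := hK.exists_bound_of_continuousOn hp.differentiable.continuous.continuousOn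
  obtain ⟨M', hM'⟩ := hK.exists_bound_of_continuousOn
    (hp.differentiable.contDiff (n := 1)).continuous_deriv_one.continuousOn
  set m := ‖p w₀‖ with hm
  have hm0 : 0 < m := norm_pos_iff.2 (hp.ne_zero w₀)
  have hM0 : 0 < M := hm0.trans_le ((hmin (by simpa using hρ : (0 : ℂ) ∈ _)).trans
    (hM 0 (by simpa using hρ)))
  have hM'0 : 0 ≤ M' := (norm_nonneg _).trans (hM' 0 (by simpa using hρ))
  have hδ : 0 < min 1 (min (κ / M) (m / 2 / M)) := by positivity
  set δ := min 1 (min (κ / M) (m / 2 / M)) with hδdef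
  have hδ1 : δ ≤ 1 := min_le_left _ _
  have hδ2 : M * δ ≤ κ := by
    have : δ ≤ κ / M := (min_le_right _ _).trans (min_le_left _ _)
    rw [le_div_iff₀ hM0] at this
    linarith
  have hδ3 : M * δ ≤ m / 2 := by
    have : δ ≤ m / 2 / M := (min_le_right _ _).trans (min_le_right _ _)
    rw [le_div_iff₀ hM0] at this
    linarith
  -- The perturbed block has norm at least `m / 2`, and derivative at most `M' + (M + M')`.
  refine ⟨δ, (M' + (M + M')) ^ 2 / (m / 2) ^ 2, hδ, by positivity, fun w hw => ?_,
    fun w hw s s' hs hs' => ?_⟩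
  · have h1 : ‖p w 0‖ ≤ M := (PiLp.norm_apply_le _ _).trans (hM w ((hmem w).1 hw))
    exact (mul_le_mul_of_nonneg_right h1 hδ.le).trans hδ2
  · have h1 : ‖p w 0‖ ≤ M := (PiLp.norm_apply_le _ _).trans (hM w ((hmem w).1 hw))
    have h2 : ‖deriv p w‖ ≤ M' := hM' w ((hmem w).1 hw)
    have h3 : ‖deriv p w 0‖ ≤ M' := (PiLp.norm_apply_le _ _).trans h2
    have h4 : m ≤ ‖p w‖ := hmin ((hmem w).1 hw)
    have h5 : ‖p w 0 • s‖ ≤ m / 2 := by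
      rw [norm_smul]
      exact (mul_le_mul h1 hs (norm_nonneg _) hM0.le).trans hδ3
    have h6 : m / 2 ≤ ‖p w + p w 0 • s‖ := by
      have := norm_sub_le (p w + p w 0 • s) (p w 0 • s)
      rw [add_sub_cancel_right] at this
      linarith
    have h7 : ‖p w 0 • s'‖ ≤ M := by
      rw [norm_smul]
      exact (mul_le_mul h1 (hs'.trans hδ1) (norm_nonneg _) hM0.le).trans_eq (mul_one _)
    have h8 : ‖deriv p w 0 • s‖ ≤ M' := by
      rw [norm_smul]
      exact (mul_le_mul h3 (hs.trans hδ1) (norm_nonneg _) hM'0).trans_eq (mul_one _)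
    have h9 : ‖deriv p w + (p w 0 • s' + (deriv p w) 0 • s)‖ ≤ M' + (M + M') :=
      (norm_add_le _ _).trans (add_le_add h2 ((norm_add_le _ _).trans (add_le_add h7 h8)))
    gcongr

theorem exists_separated_seq {r N : ℕ → ℝ} (hr : ∀ j, 0 ≤ r j) (hN : ∀ j, 0 ≤ N j) :
    ∃ a : ℕ → ℝ, (∀ i j, i ≠ j → r i + r j ≤ |a i - a j|) ∧ ∀ j, r j + N j ≤ a j := by
  set a : ℕ → ℝ := fun j =>
    ∑ i ∈ Finset.range (j + 1), (r i + N i) + ∑ i ∈ Finset.range j, r i with ha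
  have hc : ∀ i, 0 ≤ r i + N i := fun i => add_nonneg (hr i) (hN i)
  have hlt : ∀ i j, i < j → r i + r j ≤ a j - a i := by
    intro i j hij
    have h1 : ∑ l ∈ Finset.range (i + 1), (r l + N l) ≤ ∑ l ∈ Finset.range j, (r l + N l) :=
      Finset.sum_le_sum_of_subset_of_nonneg (Finset.range_mono hij) fun l _ _ => hc l
    have h2 : ∑ l ∈ Finset.range (i + 1), r l ≤ ∑ l ∈ Finset.range j, r l :=
      Finset.sum_le_sum_of_subset_of_nonneg (Finset.range_mono hij) fun l _ _ => hr l
    rw [Finset.sum_range_succ] at h2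
    simp only [ha]
    rw [Finset.sum_range_succ (fun i => r i + N i) j]
    linarith [hN j]
  refine ⟨a, fun i j hij => ?_, fun j => ?_⟩
  · rcases lt_or_gt_of_ne hij with h | h
    · rw [abs_sub_comm]
      exact (hlt i j h).trans (le_abs_self _)
    · rw [add_comm]
      exact (hlt j i h).trans (le_abs_self _)
  · simp only [ha]
    rw [Finset.sum_range_succ]
    have h1 : 0 ≤ ∑ l ∈ Finset.range j, (r l + N l) := Finset.sum_nonneg fun l _ => hc l
    have h2 : 0 ≤ ∑ l ∈ Finset.range j, r l := Finset.sum_nonneg fun l _ => hr l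
    linarith

theorem Arrangement.isUniversal_curve {n : ℕ} (hn : 1 ≤ n) (A : Arrangement n)
    (hρ : ∀ j : ℕ, (j : ℝ) ≤ A.ρ j)
    (hδ : ∀ (j : ℕ) (w : ℂ), ‖w‖ ≤ A.ρ j → ‖A.p j w 0‖ * A.δ j ≤ 1 / ((j : ℝ) + 1))
    (hdense : ∀ q : ℂ → EuclideanSpace ℂ (Fin (n + 1)), IsBlock q → ∀ R ε : ℝ, 0 < ε →
      ∀ N : ℕ, ∃ j, N ≤ j ∧ ∀ z ∈ Metric.closedBall (0 : ℂ) R, ‖A.p j z - q z‖ < ε) :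
    IsUniversal A.curve := by
  refine ⟨A.isEntireCurve_curve, fun g hg K hK => ?_⟩
  obtain ⟨R, hRK⟩ : ∃ R, K ⊆ Metric.closedBall (0 : ℂ) R :=
    hK.isBounded.subset_closedBall 0
  replace hRK : K ⊆ Metric.closedBall (0 : ℂ) (max R 0) :=
    hRK.trans (Metric.closedBall_subset_closedBall (le_max_left _ _))
  set R' := max R 0 with hR'
  obtain ⟨G, m, hm, hG, happ⟩ := hg.exists_isBlock_approx hn (le_max_right R 0)
  have hex : ∀ ε : ℝ, 0 < ε →
      ∃ j, ∀ z ∈ Metric.closedBall (0 : ℂ) R', fsDist (A.curve (z + A.a j)) (g z) < ε := by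
    intro ε hε
    obtain ⟨δ, hδ0, hfs⟩ := exists_fsDist_lt (n := n) hε
    obtain ⟨q, hq, hqG⟩ := happ (δ * m / 3) (by positivity)
    obtain ⟨N₁, hN₁⟩ := exists_nat_one_div_lt (by positivity : 0 < δ * m / 3)
    obtain ⟨N₂, hN₂⟩ := exists_nat_ge R'
    obtain ⟨j, hj, hjq⟩ := hdense q hq R' (δ * m / 3) (by positivity) (max N₁ N₂)
    refine ⟨j, fun z hz => ?_⟩
    have hjN₁ : (N₁ : ℝ) ≤ j := by exact_mod_cast (le_max_left _ _).trans hj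
    have hjN₂ : (N₂ : ℝ) ≤ j := by exact_mod_cast (le_max_right _ _).trans hj
    have hzR : ‖z‖ ≤ R' := by simpa using hz
    have hzρ : ‖z‖ ≤ A.ρ j := by linarith [hρ j]
    have hreg : z + A.a j ∈ A.region (some j) :=
      A.mem_region_some (by rwa [add_sub_cancel_right])
    obtain ⟨hmG, hGz, hgz⟩ := hG z hz
    rw [A.curve_eq hreg, hgz]
    refine hfs _ _ _ _ ?_
    have h1 : ‖A.lift (some j) (z + A.a j) - A.p j z‖ ≤ δ * m / 3 := by
      refine ((A.norm_lift_sub_le hzρ).trans (hδ j z hzρ)).trans (le_trans ?_ hN₁.le)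
      exact one_div_le_one_div_of_le (by positivity) (by linarith)
    have h2 := hjq z hz
    have h3 := hqG z hz
    calc ‖A.lift (some j) (z + A.a j) - G z‖
        = ‖(A.lift (some j) (z + A.a j) - A.p j z) + (A.p j z - q z) + (q z - G z)‖ := by
          congr 1; abel
      _ ≤ δ * m / 3 + δ * m / 3 + δ * m / 3 :=
          norm_add₃_le.trans (add_le_add (add_le_add h1 h2.le) h3.le)
      _ = δ * m := by ring
      _ ≤ δ * ‖G z‖ := by gcongr
  choose! j hj using hex
  refine ⟨fun i => A.a (j (1 / ((i : ℝ) + 1))), fun ε hε => ?_⟩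
  have hlim : ∀ᶠ i : ℕ in atTop, 1 / ((i : ℝ) + 1) < ε :=
    tendsto_one_div_add_atTop_nhds_zero_nat.eventually_lt_const hε
  filter_upwards [hlim] with i hi z hz
  exact (hj _ (by positivity) z (hRK hz)).trans hi

theorem Arrangement.characteristic_curve_le {n : ℕ} (A : Arrangement n) {φ : ℝ → ℝ} {c : ℝ}
    (hc : ∀ r : ℝ, 1 ≤ r → c ≤ φ r)
    (hε : A.ε * ∫ w : ℂ, (1 + ‖w‖) ^ (-3 : ℝ) ≤ c)
    (hφ : ∀ (k : ℕ) (r : ℝ), ‖A.a k‖ - A.ρ k ≤ r → c + ∑ i ∈ Finset.range (k + 1),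
      volume.real (Metric.closedBall (0 : ℂ) (A.ρ i)) * A.b i ≤ φ r) {r : ℝ} (hr : 1 ≤ r) :
    characteristic A.curve r ≤ φ r * Real.log r := by
  refine characteristic_le hr fun t ht => ?_
  have hI : 0 ≤ ∫ w : ℂ, (1 + ‖w‖) ^ (-3 : ℝ) := integral_nonneg fun w => by positivity
  have hε' : A.ε * (A.ε * ∫ w : ℂ, (1 + ‖w‖) ^ (-3 : ℝ)) ≤ c :=
    (mul_le_of_le_one_left (mul_nonneg A.ε_pos.le hI) A.ε_le).trans hε
  by_cases hne : {i : ℕ | ‖A.a i‖ - A.ρ i < r}.Nonempty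
  · have hfin : {i : ℕ | ‖A.a i‖ - A.ρ i < r}.Finite := by
      obtain ⟨N, hN⟩ := exists_nat_ge r
      refine (Set.finite_lt_nat N).subset fun i hi => ?_
      have h1 : ‖A.a i‖ - A.ρ i < r := hi
      have h2 : (i : ℝ) < N := by linarith [A.escape i]
      exact_mod_cast h2
    obtain ⟨k, hk, hmax⟩ := Set.exists_max_image _ id hfin hne
    refine (A.integral_pullbackFS_le (Finset.range (k + 1))
      (fun i hi => Finset.mem_range.2 (Nat.lt_succ_of_le (hmax i hi))) ht.2).trans
      (le_trans ?_ (hφ k r hk.le))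
    gcongr
  · refine (A.integral_pullbackFS_le ∅ (fun i hi => absurd ⟨i, hi⟩ hne) ht.2).trans ?_
    rw [Finset.sum_empty, add_zero]
    exact hε'.trans (hc r hr)

end UniversalCurve


theorem theorem1 (n : ℕ) (hn : 1 ≤ n) (φ : ℝ → ℝ)
    (hcont : ContinuousOn φ (Set.Ioi 0))
    (hpos : ∀ r : ℝ, 0 < r → 0 < φ r)
    (hlim : Tendsto φ atTop atTop) :
    ∃ h : ℂ → UniversalCurve.CP n, UniversalCurve.IsUniversal h ∧
      ∀ r : ℝ, 1 ≤ r → UniversalCurve.characteristic h r ≤ φ r * Real.log r := by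
  obtain ⟨c, hc0, hc⟩ := UniversalCurve.exists_pos_le_of_tendsto_atTop hcont hpos hlim
  obtain ⟨q, hq, hdense⟩ := UniversalCurve.exists_dense_seq_isBlock hn
  set I : ℝ := ∫ w : ℂ, (1 + ‖w‖) ^ (-3 : ℝ) with hI
  have hI0 : 0 ≤ I := integral_nonneg fun w => by positivity
  have hε : 0 < min 1 (c / (I + 1)) := by positivity
  set ε := min 1 (c / (I + 1)) with hεdef
  have hεI : ε * I ≤ c := by
    have h1 : ε ≤ c / (I + 1) := min_le_right _ _
    rw [le_div_iff₀ (by positivity)] at h1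
    linarith
  -- Every term of the dense sequence is repeated infinitely often.
  set p : ℕ → ℂ → EuclideanSpace ℂ (Fin (n + 1)) := fun j => q (Nat.unpair j).1 with hp
  have hpB : ∀ j, UniversalCurve.IsBlock (p j) := fun j => hq _
  choose ρ₀ hρ₀ using fun j : ℕ =>
    (hpB j).exists_affinePart_le (show 0 < ε / 2 / 2 ^ j by positivity)
  set ρ : ℕ → ℝ := fun j => max (ρ₀ j) j with hρ
  have hρj : ∀ j : ℕ, (j : ℝ) ≤ ρ j := fun j => le_max_right _ _
  have hρ0 : ∀ j, 0 ≤ ρ j := fun j => (Nat.cast_nonneg j).trans (hρj j)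
  choose δ b hδ hb hδκ hdens using fun j : ℕ =>
    (hpB j).exists_density_le (hρ0 j) (show 0 < 1 / ((j : ℝ) + 1) by positivity)
  choose M hM using fun k : ℕ => eventually_atTop.1 (hlim.eventually_ge_atTop
    (c + ∑ i ∈ Finset.range (k + 1), volume.real (Metric.closedBall (0 : ℂ) (ρ i)) * b i))
  obtain ⟨a, hsep, ha⟩ := UniversalCurve.exists_separated_seq
    (r := fun j => ρ j + (δ j)⁻¹) (N := fun j => max (M j) j)
    (fun j => add_nonneg (hρ0 j) (inv_pos.2 (hδ j)).le)
    (fun j => (Nat.cast_nonneg j).trans (le_max_right _ _))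
  have ha' : ∀ j, ρ j + max (M j) j ≤ ‖(a j : ℂ)‖ := fun j => by
    rw [Complex.norm_real]
    exact (le_trans (by linarith [inv_pos.2 (hδ j)]) (ha j)).trans (le_abs_self _)
  let A : UniversalCurve.Arrangement n :=
    { p := p, a := fun j => a j, ρ := ρ, δ := δ, b := b, ε := ε
      isBlock := hpB
      far := fun j w hw => hρ₀ j w ((le_max_left _ _).trans hw)
      ρ_nonneg := hρ0
      δ_pos := hδ
      b_nonneg := hb
      density_le := hdens
      ε_pos := hε
      ε_le := min_le_left _ _
      sep := fun i j hij => by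
        rw [← Complex.ofReal_sub, Complex.norm_real]
        exact le_trans (by linarith [inv_pos.2 (hδ j)]) (hsep i j hij)
      escape := fun j => by linarith [ha' j, le_max_right (M j) j] }
  refine ⟨A.curve, A.isUniversal_curve hn hρj hδκ fun g hg R η hη N => ?_, fun r hr =>
    A.characteristic_curve_le hc hεI (fun k s hs => hM k s ?_) hr⟩
  · obtain ⟨k, hk⟩ := hdense g hg R η hη
    refine ⟨Nat.pair k N, Nat.right_le_pair k N, fun z hz => ?_⟩
    change ‖q (Nat.unpair (Nat.pair k N)).1 z - g z‖ < η
    rw [Nat.unpair_pair]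
    exact hk z hz
  · have h1 : ‖(a k : ℂ)‖ - ρ k ≤ s := hs
    linarith [ha' k, le_max_left (M k) k]
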